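/- Let $n\ge 2$, let $\mathcal M$ be a Riemannian $n$-manifold (smooth, without boundary, second countable) with Riemannian distance and Riemannian volume measure $\sigma$, and let $\Lambda\subset\mathcal M$ be a compact set. Let $\{D_i\}_{i\in I}$ be the connected components of $\mathcal M\setminus\Lambda$, and let $\Gamma$ be an arbitrary family of curves in $\mathcal M$, a curve being a continuous map of a compact interval into $\mathcal M$. The $n$-modulus of a curve family $\Gamma_0$ is $\mathrm{mod}_n(\Gamma_0)=\inf\int_{\mathcal M}\rho^n\,d\sigma$, the infimum being over all Borel functions $\rho\colon\mathcal M\to[0,\infty]$ with $\int_\gamma\rho\,ds\ge 1$ for every rectifiable $\gamma\in\Gamma_0$. A mass distribution $\rho$ consists of a Borel measurable function $\rho\colon\Lambda\to[0,\infty)$ and a number $\rho(D_i)\in[0,\infty)$ for each $i\in I$; its total mass is $$\mathrm{mass}(\rho)=\int_\Lambda\rho^n\,d\sigma+\sum_{i\in I}\rho(D_i)^n .$$ It is admissible for $\Gamma$ if there is a subfamily $\Gamma_0\subseteq\Gamma$ with $\mathrm{mod}_n(\Gamma_0)=0$ such that $$\int_{\gamma\cap\Lambda}\rho\,ds+\sum_{i:\,\gamma\cap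 D_i\ne\emptyset}\rho(D_i)\ge 1\qquad\text{for every }\gamma\in\Gamma\setminus\Gamma_0 .$$ The transboundary modulus $\mathrm{mod}_\Lambda(\Gamma)$ is the infimum of $\mathrm{mass}(\rho)$ over all admissible mass distributions $\rho$ (with $\inf\emptyset=\infty$), and an admissible $\rho$ is extremal if $\mathrm{mass}(\rho)=\mathrm{mod}_\Lambda(\Gamma)$. Suppose that $\mathrm{mod}_\Lambda(\Gamma)<\infty$ and that $\{D_i\}_{i\in I}$ has bounded geometry: there exist $C\ge 1$, $p_i\in D_i$ and $0<r_i\le R_i$ $(i\in I)$ with $B(p_i,r_i)\subseteq D_i\subseteq B(p_i,R_i)$ and $R_i/r_i\le C$ for all $i\in I$, where $B(p,r)$ is the open ball with center $p$ and radius $r$. Then an extremal mass distribution exists, it belongs to $L^n(\Lambda)\oplus \ell^n(I)$, and it is unique as an element of $L^n(\Lambda)\oplus \ell^n(I)$, i.e. any two extremal mass distributions agree $\sigma$-almost everywhere on $\Lambda$ and have the same value on every $D_i$. -/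

import Mathlib

open MeasureTheory Set Bundle
open scoped ENNReal NNReal Manifold ContDiff Bundle

noncomputable section

namespace Transboundary

/-- A path (or curve) in `M`: a continuous map of a compact interval into `M`; after an affine
change of parameter the interval is `[0, 1]`. Closed curves are those with equal end points. -/
abbrev Curve (M : Type*) [TopologicalSpace M] := C(unitInterval, M)

section Metric

variable {M : Type*} [EMetricSpace M]

/-- The length of a curve: the supremum of the lengths of inscribed polygons. -/
def curveLength (γ : Curve M) : ℝ≥0∞ := eVariationOn γ univ

/-- A curve is rectifiable if its length is finite. -/
def Rectifiable (γ : Curve M) : Prop := curveLength γ ≠ ⊤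

/-- The line integral `∫_γ ρ ds` of a non-negative function over a rectifiable curve, computed in
the arc-length parametrization of the curve on `[0, length γ]`. -/
def lineIntegral (ρ : M → ℝ≥0∞) (γ : Curve M) : ℝ≥0∞ :=
  ∫⁻ s in Icc (0 : ℝ) (curveLength γ).toReal, ρ (naturalParameterization γ univ 0 s)

/-- The connected components of the complement of `Λ`. -/
def complComponents (Λ : Set M) : Set (Set M) := connectedComponentIn Λᶜ '' Λᶜ

/-- Bounded geometry of a collection of sets `D i`: there are `C ≥ 1`, points `p i ∈ D i` and radii
`0 < r i ≤ R i` with `B(p i, r i) ⊆ D i ⊆ B(p i, R i)` and `R i / r i ≤ C`. -/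
def BoundedGeometry {ι : Type*} (D : ι → Set M) : Prop :=
  ∃ C : ℝ, 1 ≤ C ∧ ∃ (p : ι → M) (r R : ι → ℝ), ∀ i,
    p i ∈ D i ∧ 0 < r i ∧ r i ≤ R i ∧
    Metric.eball (p i) (ENNReal.ofReal (r i)) ⊆ D i ∧
    D i ⊆ Metric.eball (p i) (ENNReal.ofReal (R i)) ∧
    R i / r i ≤ C

variable [MeasurableSpace M]

/-- A mass distribution for `Λ`: a measurable non-negative function on `Λ` (the continuous part) and
a non-negative number for each complementary component of `Λ` (the discrete part). The continuous
part is written as a function on `M`; only its values on `Λ` are ever used. -/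
structure MassDistribution (Λ : Set M) where
  /-- the continuous part -/
  cont : M → ℝ≥0
  measurable_cont : Measurable cont
  /-- the discrete part -/
  disc : complComponents Λ → ℝ≥0

/-- The left-hand side of the admissibility condition:
`∫_{γ ∩ Λ} ρ ds + ∑_{γ ∩ D_i ≠ ∅} ρ(D_i)`. -/
def MassDistribution.along {Λ : Set M} (ρ : MassDistribution Λ) (γ : Curve M) : ℝ≥0∞ :=
  lineIntegral (Λ.indicator fun x => (ρ.cont x : ℝ≥0∞)) γ +
    ∑' D : {D : complComponents Λ // (range γ ∩ (D : Set M)).Nonempty}, (ρ.disc D.1 : ℝ≥0∞)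

variable [BorelSpace M]

/-- The volume measure of a Riemannian `n`-manifold, as the `n`-dimensional Hausdorff measure of its
Riemannian distance, normalized to agree with Lebesgue measure on `ℝⁿ`. -/
def riemannianVolume (n : ℕ) : Measure M := μHE[n]

/-- A mass density is admissible for the `n`-modulus of `Γ` if it is measurable and
`∫_γ ρ ds ≥ 1` for every (rectifiable) `γ ∈ Γ`. -/
def AdmissibleDensity (Γ : Set (Curve M)) (ρ : M → ℝ≥0∞) : Prop :=
  Measurable ρ ∧ ∀ γ ∈ Γ, Rectifiable γ → 1 ≤ lineIntegral ρ γ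

/-- The `n`-modulus of a curve family. -/
def modulus (n : ℕ) (Γ : Set (Curve M)) : ℝ≥0∞ :=
  ⨅ (ρ : M → ℝ≥0∞) (_ : AdmissibleDensity Γ ρ), ∫⁻ x, ρ x ^ n ∂(riemannianVolume n)

/-- The total mass `∫_Λ ρⁿ dσ + ∑ i, ρ(D_i)ⁿ` of a mass distribution. -/
def MassDistribution.mass (n : ℕ) {Λ : Set M} (ρ : MassDistribution Λ) : ℝ≥0∞ :=
  ∫⁻ x in Λ, (ρ.cont x : ℝ≥0∞) ^ n ∂(riemannianVolume n) +
    ∑' D : complComponents Λ, (ρ.disc D : ℝ≥0∞) ^ n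

/-- Admissibility of a mass distribution for the transboundary modulus of `Γ`: the admissibility
inequality holds on `Γ` outside an exceptional subfamily of `n`-modulus zero. -/
def MassDistribution.Admissible (n : ℕ) {Λ : Set M} (Γ : Set (Curve M))
    (ρ : MassDistribution Λ) : Prop :=
  ∃ Γ₀ ⊆ Γ, modulus n Γ₀ = 0 ∧ ∀ γ ∈ Γ \ Γ₀, 1 ≤ ρ.along γ

/-- The transboundary modulus of `Γ` with respect to `Λ`. -/
def transboundaryModulus (n : ℕ) (Λ : Set M) (Γ : Set (Curve M)) : ℝ≥0∞ :=
  ⨅ (ρ : MassDistribution Λ) (_ : ρ.Admissible n Γ), ρ.mass n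

/-- An extremal mass distribution: an admissible one that achieves the infimum in the definition of
the transboundary modulus. -/
def MassDistribution.IsExtremal (n : ℕ) {Λ : Set M} (Γ : Set (Curve M))
    (ρ : MassDistribution Λ) : Prop :=
  ρ.Admissible n Γ ∧ ρ.mass n = transboundaryModulus n Λ Γ

/-- The Banach space `Lⁿ(Λ) ⊕ lⁿ`, with the norm `(‖·‖ⁿ + ‖·‖ⁿ)^(1/n)`. -/
abbrev LnSum (n : ℕ) (Λ : Set M) : Type _ :=
  WithLp (n : ℝ≥0∞) (Lp ℝ (n : ℝ≥0∞) ((riemannianVolume n).restrict Λ) ×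
    lp (fun _ : complComponents Λ => ℝ) (n : ℝ≥0∞))

/-- The mass distribution `ρ`, regarded up to null sets of `Λ`, is the element `x` of
`Lⁿ(Λ) ⊕ lⁿ`. -/
def MassDistribution.Represents {n : ℕ} {Λ : Set M} (ρ : MassDistribution Λ)
    (x : LnSum n Λ) : Prop :=
  (∀ᵐ y ∂((riemannianVolume n).restrict Λ), x.fst y = (ρ.cont y : ℝ)) ∧
    ∀ D : complComponents Λ, x.snd D = (ρ.disc D : ℝ)

end Metric

end Transboundary

end

/-! The mass is the `n`-th power of the norm of a uniformly convex space, and the extremal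
distribution is the point of least norm in a convex set. A midpoint of two admissible distributions
is again admissible, so Clarkson's inequality bounds the distance of two admissible distributions by
the excess of their masses over the infimum (`MassDistribution.Admissible.mass_halfDist_le`). This
gives uniqueness, and it makes minimizing sequences Cauchy.

The main point is that the limit is still admissible outside a family of modulus zero. Choose the
minimizing sequence so that its steps decay geometrically; they are then dominated by `2⁻ᵏ` times a
pair `(w, a)` in `Lⁿ(Λ) ⊕ ℓⁿ`. The limit inherits admissibility along every curve `γ` for which `∫_γ
w ds` and the sum of `a(D)` over the components met by `γ` are both finite. The integral is finite
off a family of modulus zero, as in Fuglede's lemma (`modulus_lineIntegral_eq_top`).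

Bounded geometry is what controls the sum (`BoundedGeometry.exists_density`). Let `g` be the sum of
`(a(D)/R_D) 1_{B(p_D, 2R_D)}` over the small components close to `Λ`. A curve that meets `D` and
leaves `B(p_D, 2R_D)` has length at least `R_D` in that ball, so `D` contributes at least `a(D)` to
`∫_γ g ds`. For a curve meeting at least two components, this covers all but finitely many of those
it meets. Bojarski's lemma (`BallFamily.lintegral_tsum_pow_le`) replaces the overlapping balls by
the disjoint balls `B(p_D, r_D)`. Since their volume is comparable to `r_Dⁿ`, the integral of `gⁿ`
is at most a constant times the sum of `a(D)ⁿ`. -/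

namespace Transboundary

/-! ### Arc-length parametrization and line integrals. -/

section ArcLength

variable {M : Type*} [EMetricSpace M] {γ : Curve M}

theorem Rectifiable.locallyBoundedVariationOn (hγ : Rectifiable γ) :
    LocallyBoundedVariationOn γ univ :=
  BoundedVariationOn.locallyBoundedVariationOn hγ

/-- At a point of continuity, the variation over a shrinking one-sided interval tends to zero.
Continuity makes the arc-length function map onto the whole interval `[0, length γ]`. -/
theorem Rectifiable.continuous_variationOnFromTo (hγ : Rectifiable γ) :
    Continuous (variationOnFromTo γ univ 0) := by
  rw [continuous_iff_continuousAt]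
  intro x
  have hb : BoundedVariationOn γ univ := hγ
  have h1 := hb.tendsto_eVariationOn_Icc_zero_left (x := x) γ.continuous.continuousWithinAt
  have h2 := hb.tendsto_eVariationOn_Icc_zero_right x γ.continuous.continuousWithinAt
  rw [nhdsWithin_univ] at h1 h2
  have h3 := ((ENNReal.tendsto_toReal ENNReal.zero_ne_top).comp h1).add
    ((ENNReal.tendsto_toReal ENNReal.zero_ne_top).comp h2)
  rw [ContinuousAt, tendsto_iff_dist_tendsto_zero]
  refine squeeze_zero (fun _ => dist_nonneg) (fun y => ?_) (by simpa using h3)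
  rw [Real.dist_eq, variationOnFromTo.sub_right hγ.locallyBoundedVariationOn (mem_univ _)
    (mem_univ _) (mem_univ _)]
  rcases le_total x y with h | h
  · rw [variationOnFromTo.eq_of_le _ _ h, abs_of_nonneg ENNReal.toReal_nonneg]
    simp
  · rw [variationOnFromTo.eq_of_ge _ _ h, abs_neg, abs_of_nonneg ENNReal.toReal_nonneg]
    simp

theorem variationOnFromTo_zero_one (γ : Curve M) :
    variationOnFromTo γ univ 0 1 = (curveLength γ).toReal := by
  rw [variationOnFromTo.eq_of_le _ _ zero_le_one]
  congr 2
  ext t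
  simp [unitInterval.le_one']

theorem Rectifiable.variationOnFromTo_mem (hγ : Rectifiable γ) (t : unitInterval) :
    variationOnFromTo γ univ 0 t ∈ Icc 0 (curveLength γ).toReal := by
  refine ⟨variationOnFromTo.nonneg_of_le _ _ unitInterval.nonneg', ?_⟩
  rw [← variationOnFromTo_zero_one]
  exact variationOnFromTo.monotoneOn hγ.locallyBoundedVariationOn (mem_univ _) (mem_univ _)
    (mem_univ _) unitInterval.le_one'

theorem Rectifiable.image_variationOnFromTo (hγ : Rectifiable γ) :
    variationOnFromTo γ univ 0 '' univ = Icc 0 (curveLength γ).toReal := by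
  apply Subset.antisymm
  · rintro _ ⟨t, -, rfl⟩
    exact hγ.variationOnFromTo_mem t
  · have := intermediate_value_univ (0 : unitInterval) 1 hγ.continuous_variationOnFromTo
    rwa [variationOnFromTo.self, variationOnFromTo_zero_one, ← image_univ] at this

theorem Rectifiable.naturalParameterization_variationOnFromTo (hγ : Rectifiable γ)
    (t : unitInterval) :
    naturalParameterization γ univ 0 (variationOnFromTo γ univ 0 t) = γ t :=
  edist_eq_zero.1 <| edist_naturalParameterization_eq_zero hγ.locallyBoundedVariationOn
    (mem_univ _) (mem_univ _)

theorem Rectifiable.lipschitzOnWith (hγ : Rectifiable γ) :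
    LipschitzOnWith 1 (naturalParameterization γ univ 0) (Icc 0 (curveLength γ).toReal) := by
  have h := has_unit_speed_naturalParameterization γ hγ.locallyBoundedVariationOn
    (mem_univ (0 : unitInterval))
  rw [hγ.image_variationOnFromTo] at h
  have key : ∀ x ∈ Icc 0 (curveLength γ).toReal, ∀ y ∈ Icc 0 (curveLength γ).toReal, x ≤ y →
      edist (naturalParameterization γ univ 0 x) (naturalParameterization γ univ 0 y)
        ≤ edist x y := by
    intro x hx y hy hxy
    refine (eVariationOn.edist_le _ (s := Icc 0 (curveLength γ).toReal ∩ Icc x y)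
      ⟨hx, le_rfl, hxy⟩ ⟨hy, hxy, le_rfl⟩).trans ?_
    rw [h hx hy, edist_comm x y, edist_dist, Real.dist_eq, abs_of_nonneg (sub_nonneg.2 hxy)]
    simp
  intro x hx y hy
  rw [ENNReal.coe_one, one_mul]
  rcases le_total x y with hxy | hxy
  · exact key x hx y hy hxy
  · rw [edist_comm, edist_comm x]
    exact key y hy x hx hxy

theorem lineIntegral_mono {f g : M → ℝ≥0∞} (h : f ≤ g) (γ : Curve M) :
    lineIntegral f γ ≤ lineIntegral g γ :=
  lintegral_mono fun _ => h _

theorem lineIntegral_const_mul {r : ℝ≥0∞} (hr : r ≠ ⊤) (f : M → ℝ≥0∞) (γ : Curve M) :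
    lineIntegral (fun x => r * f x) γ = r * lineIntegral f γ :=
  lintegral_const_mul' _ _ hr

/-- A curve that meets `B(p, R)` but is not contained in `B(p, 2R)` has length at least `R` inside
`B(p, 2R)`. -/
theorem Rectifiable.le_lineIntegral_indicator_eball (hγ : Rectifiable γ) {p : M} {R : ℝ}
    {t u : unitInterval} (ht : γ t ∈ Metric.eball p (ENNReal.ofReal R))
    (hu : γ u ∉ Metric.eball p (ENNReal.ofReal (2 * R))) :
    ENNReal.ofReal R ≤
      lineIntegral ((Metric.eball p (ENNReal.ofReal (2 * R))).indicator 1) γ := by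
  have hR : 0 < R := by
    rw [← ENNReal.ofReal_pos]
    exact pos_of_gt (Metric.mem_eball.1 ht)
  set L := (curveLength γ).toReal
  set φ := naturalParameterization γ univ 0
  obtain ⟨a, ha⟩ : ∃ a, a = variationOnFromTo γ univ 0 t := ⟨_, rfl⟩
  obtain ⟨b, hb⟩ : ∃ b, b = variationOnFromTo γ univ 0 u := ⟨_, rfl⟩
  have haL : a ∈ Icc 0 L := ha ▸ hγ.variationOnFromTo_mem t
  have hbL : b ∈ Icc 0 L := hb ▸ hγ.variationOnFromTo_mem u
  have hφa : φ a = γ t := ha ▸ hγ.naturalParameterization_variationOnFromTo t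
  have hφb : φ b = γ u := hb ▸ hγ.naturalParameterization_variationOnFromTo u
  -- The natural parametrization is 1-Lipschitz and `φ a` lies in `B(p, R)`, so arc-length distance
  -- at most `R` from `a` keeps the curve in `B(p, 2R)`.
  have hball : ∀ s ∈ Icc 0 L, |s - a| ≤ R → φ s ∈ Metric.eball p (ENNReal.ofReal (2 * R)) := by
    intro s hs hsa
    have h1 : edist (φ s) (φ a) ≤ ENNReal.ofReal R := by
      refine (hγ.lipschitzOnWith hs haL).trans ?_
      rw [ENNReal.coe_one, one_mul, edist_dist, Real.dist_eq]
      exact ENNReal.ofReal_le_ofReal hsa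
    rw [Metric.mem_eball, two_mul, ENNReal.ofReal_add hR.le hR.le]
    refine (edist_triangle _ (φ a) _).trans_lt ?_
    exact ENNReal.add_lt_add_of_le_of_lt (ne_top_of_le_ne_top ENNReal.ofReal_ne_top h1) h1
      (by rw [hφa]; exact ht)
  have hab : R < |b - a| := by
    by_contra! h
    exact hu (hφb ▸ hball b hbL h)
  have key : ∀ I : Set ℝ, MeasurableSet I → volume I = ENNReal.ofReal R → I ⊆ Icc 0 L →
      (∀ s ∈ I, |s - a| ≤ R) → ENNReal.ofReal R ≤
        lineIntegral ((Metric.eball p (ENNReal.ofReal (2 * R))).indicator 1) γ := by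
    intro I hI hvol hIL hIa
    calc ENNReal.ofReal R = ∫⁻ s in I, 1 := by simp [hvol]
      _ ≤ ∫⁻ s in I, (Metric.eball p (ENNReal.ofReal (2 * R))).indicator 1 (φ s) := by
        refine setLIntegral_mono' hI fun s hs => ?_
        rw [indicator_of_mem (hball s (hIL hs) (hIa s hs))]
        rfl
      _ ≤ _ := lintegral_mono_set hIL
  -- Since `|b - a| > R`, the interval of length `R` that starts at `a` and points towards `b` stays
  -- inside `[0, L]`.
  rcases le_total a b with h | h
  · rw [abs_of_nonneg (sub_nonneg.2 h)] at hab
    refine key (Icc a (a + R)) measurableSet_Icc (by simp)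
      (Icc_subset_Icc haL.1 (by linarith [hbL.2])) fun s hs => ?_
    rw [abs_of_nonneg (sub_nonneg.2 hs.1)]
    linarith [hs.2]
  · rw [abs_of_nonpos (sub_nonpos.2 h)] at hab
    refine key (Icc (a - R) a) measurableSet_Icc (by simp)
      (Icc_subset_Icc (by linarith [hbL.1]) haL.2) fun s hs => ?_
    rw [abs_of_nonpos (sub_nonpos.2 hs.2)]
    linarith [hs.1]

variable [MeasurableSpace M] [BorelSpace M]

theorem Rectifiable.aemeasurable (hγ : Rectifiable γ) :
    AEMeasurable (naturalParameterization γ univ 0)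
      (volume.restrict (Icc 0 (curveLength γ).toReal)) :=
  hγ.lipschitzOnWith.continuousOn.aemeasurable measurableSet_Icc

theorem lineIntegral_add (hγ : Rectifiable γ) {f : M → ℝ≥0∞} (hf : Measurable f) (g : M → ℝ≥0∞) :
    lineIntegral (fun x => f x + g x) γ = lineIntegral f γ + lineIntegral g γ :=
  lintegral_add_left' (hf.comp_aemeasurable hγ.aemeasurable) _

theorem lineIntegral_tsum {ι : Type*} [Countable ι] (hγ : Rectifiable γ) {f : ι → M → ℝ≥0∞}
    (hf : ∀ i, Measurable (f i)) :
    lineIntegral (fun x => ∑' i, f i x) γ = ∑' i, lineIntegral (f i) γ :=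
  lintegral_tsum fun i => (hf i).comp_aemeasurable hγ.aemeasurable

end ArcLength

/-! ### Curve families of modulus zero. -/

section Modulus

variable {M : Type*} [EMetricSpace M] [MeasurableSpace M] [BorelSpace M] {n : ℕ}

theorem modulus_eq_zero_iff {Γ : Set (Curve M)} : modulus n Γ = 0 ↔
    ∀ ε : ℝ≥0∞, 0 < ε → ∃ ρ, AdmissibleDensity Γ ρ ∧
      ∫⁻ x, ρ x ^ n ∂(riemannianVolume n) < ε := by
  rw [← nonpos_iff_eq_zero]
  constructor
  · intro h ε hε
    simpa [modulus, iInf_lt_iff] using h.trans_lt hε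
  · intro h
    refine le_of_forall_gt fun ε hε => ?_
    obtain ⟨ρ, hρ, hlt⟩ := h ε hε
    exact (iInf₂_le ρ hρ).trans_lt hlt

theorem modulus_mono {Γ Γ' : Set (Curve M)} (h : Γ ⊆ Γ') : modulus n Γ ≤ modulus n Γ' :=
  le_iInf₂ fun ρ hρ => iInf₂_le ρ ⟨hρ.1, fun γ hγ => hρ.2 γ (h hγ)⟩

/-- The supremum of densities for the single families is admissible for the union, and its `n`-th
power is at most the sum of the `n`-th powers. -/
theorem modulus_iUnion_eq_zero {Γ : ℕ → Set (Curve M)}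
    (h : ∀ k, modulus n (Γ k) = 0) : modulus n (⋃ k, Γ k) = 0 := by
  rw [modulus_eq_zero_iff]
  intro ε hε
  obtain ⟨δ, hδ, hδε⟩ := ENNReal.exists_pos_sum_of_countable' hε.ne' ℕ
  choose ρ hρ hlt using fun k => modulus_eq_zero_iff.1 (h k) (δ k) (hδ k)
  refine ⟨fun x => ⨆ k, ρ k x, ⟨Measurable.iSup fun k => (hρ k).1, ?_⟩, ?_⟩
  · intro γ hγ hr
    obtain ⟨k, hk⟩ := mem_iUnion.1 hγ
    exact ((hρ k).2 γ hk hr).trans (lineIntegral_mono (fun x => le_iSup (fun k => ρ k x) k) γ)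
  · calc ∫⁻ x, (⨆ k, ρ k x) ^ n ∂(riemannianVolume n)
        ≤ ∫⁻ x, ∑' k, ρ k x ^ n ∂(riemannianVolume n) := by
          refine lintegral_mono fun x => ?_
          simp_rw [ENNReal.iSup_pow]
          exact iSup_le fun k => ENNReal.le_tsum k
      _ = ∑' k, ∫⁻ x, ρ k x ^ n ∂(riemannianVolume n) :=
          lintegral_tsum fun k => ((hρ k).1.pow_const n).aemeasurable
      _ ≤ ∑' k, δ k := ENNReal.tsum_le_tsum fun k => (hlt k).le
      _ < ε := hδε

theorem modulus_union_eq_zero {Γ Γ' : Set (Curve M)}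
    (h : modulus n Γ = 0) (h' : modulus n Γ' = 0) : modulus n (Γ ∪ Γ') = 0 := by
  rw [← nonpos_iff_eq_zero,
    ← modulus_iUnion_eq_zero (Γ := fun k => if k = 0 then Γ else Γ')
      (n := n) (fun k => by split_ifs <;> assumption)]
  refine modulus_mono (union_subset ?_ ?_)
  · exact subset_iUnion_of_subset 0 (by simp)
  · exact subset_iUnion_of_subset 1 (by simp)

/-- Admissibility only tests rectifiable curves, so the zero density is admissible; `n ≠ 0` excludes
`0 ^ 0 = 1`. -/
theorem modulus_not_rectifiable (hn : n ≠ 0) :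
    modulus n {γ : Curve M | ¬ Rectifiable γ} = 0 := by
  rw [← nonpos_iff_eq_zero]
  refine (iInf₂_le (fun _ => 0) ⟨measurable_const, fun γ hγ hr => absurd hr hγ⟩).trans ?_
  simp [hn]

/-- The rectifiable curves along which a density in `Lⁿ` is not integrable form a family of modulus
zero. -/
theorem modulus_lineIntegral_eq_top (hn : n ≠ 0) {g : M → ℝ≥0∞} (hg : Measurable g)
    (hgi : ∫⁻ x, g x ^ n ∂(riemannianVolume n) ≠ ⊤) :
    modulus n {γ : Curve M | lineIntegral g γ = ⊤} = 0 := by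
  rw [modulus_eq_zero_iff]
  intro ε hε
  -- Every multiple `c * g` with `c > 0` is admissible, since its line integrals on the family are
  -- infinite. Taking `c ≤ 1` gives `c ^ n ≤ c`, so a factor that is small enough for `c` also works
  -- for `c ^ n`.
  obtain ⟨c, hc, hcε⟩ : ∃ c : ℝ≥0∞, (c ≠ 0 ∧ c ≠ ⊤) ∧
      c ^ n * ∫⁻ x, g x ^ n ∂(riemannianVolume n) < ε := by
    obtain ⟨c, hc0, hc⟩ := ENNReal.exists_nnreal_pos_mul_lt hgi hε.ne'
    refine ⟨min c 1, ⟨?_, ?_⟩, lt_of_le_of_lt ?_ hc⟩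
    · simp [hc0.ne']
    · exact ne_top_of_le_ne_top ENNReal.one_ne_top (min_le_right _ _)
    · gcongr
      exact (pow_le_of_le_one (zero_le) (min_le_right _ _) hn).trans (min_le_left _ _)
  refine ⟨fun x => c * g x, ⟨hg.const_mul c, ?_⟩, ?_⟩
  · intro γ hγ hr
    rw [lineIntegral_const_mul hc.2, show lineIntegral g γ = ⊤ from hγ, ENNReal.mul_top hc.1]
    exact le_top
  · simp_rw [mul_pow]
    rwa [lintegral_const_mul _ (hg.pow_const n)]

end Modulus

/-! ### Bojarski's lemma on sums of characteristic functions of balls. -/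

section SumOfBalls

/-- The layer-cake formula for a single number: `a ^ (m + 1)` is the integral of `(m + 1) s ^ m`
over `0 < s < a`. -/
theorem lintegral_pow_layer (m : ℕ) {a : ℝ≥0∞} (ha : a ≠ ⊤) :
    ∫⁻ s in Ioi (0 : ℝ), {s : ℝ | ENNReal.ofReal s < a}.indicator
      (fun s => (m + 1) * ENNReal.ofReal s ^ m) s = a ^ (m + 1) := by
  lift a to ℝ≥0 using ha
  have hset : Ioi (0 : ℝ) ∩ {s : ℝ | ENNReal.ofReal s < a} = Ioo 0 (a : ℝ) := by
    ext s
    simp only [mem_inter_iff, mem_Ioi, mem_ofPred_eq, mem_Ioo, and_congr_right_iff]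
    intro hs
    rw [← ENNReal.ofReal_coe_nnreal, ENNReal.ofReal_lt_ofReal_iff_of_nonneg hs.le]
  have hm : MeasurableSet {s : ℝ | ENNReal.ofReal s < a} :=
    measurableSet_lt ENNReal.measurable_ofReal measurable_const
  rw [lintegral_indicator hm, Measure.restrict_restrict hm, inter_comm, hset,
    restrict_Ioo_eq_restrict_Ioc]
  have h1 : ∀ s ∈ Ioc (0 : ℝ) a, ((m : ℝ≥0∞) + 1) * ENNReal.ofReal s ^ m =
      ENNReal.ofReal ((m + 1) * s ^ m) := by
    intro s hs
    rw [ENNReal.ofReal_mul (by positivity), ENNReal.ofReal_pow hs.1.le,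
      ENNReal.ofReal_add (by positivity) zero_le_one, ENNReal.ofReal_natCast, ENNReal.ofReal_one]
  rw [setLIntegral_congr_fun measurableSet_Ioc h1, ← ofReal_integral_eq_lintegral_ofReal]
  · rw [← intervalIntegral.integral_of_le a.coe_nonneg, intervalIntegral.integral_const_mul,
      integral_pow,
      mul_div_cancel₀ _ (by positivity)]
    simp
  · exact ((continuous_const.mul (continuous_pow m)).integrableOn_Icc).mono_set Ioc_subset_Icc_self
  · refine (ae_restrict_iff' measurableSet_Ioc).2 (.of_forall fun s hs => ?_)
    have := hs.1.le
    positivity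

/-- A crude Young inequality, by comparing `α` with `L * c`. A large `L` makes the coefficient of `α
^ (m + 1)` small enough for absorption. -/
theorem mul_pow_le_add (m : ℕ) (c α : ℝ≥0∞) {L : ℝ≥0∞} (hL : L ≠ 0) (hL' : L ≠ ⊤) :
    c * α ^ m ≤ L ^ m * c ^ (m + 1) + L⁻¹ * α ^ (m + 1) := by
  rcases le_total α (L * c) with h | h
  · refine le_add_right ?_
    calc c * α ^ m ≤ c * (L * c) ^ m := by gcongr
      _ = L ^ m * c ^ (m + 1) := by ring
  · refine le_add_left ?_
    calc c * α ^ m = L⁻¹ * (L * c) * α ^ m := by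
          rw [← mul_assoc, ENNReal.inv_mul_cancel hL hL', one_mul]
      _ ≤ L⁻¹ * α * α ^ m := by gcongr
      _ = L⁻¹ * α ^ (m + 1) := by ring

variable {X ι : Type*} [MeasurableSpace X]

/-- A family of disjoint sets `b i` contained in sets `B i` of size about `R i`, together with
enlargements `E i` that satisfy the covering condition of the Vitali lemma, and whose measure is
comparable to that of `b i`. -/
structure BallFamily (σ : Measure X) (K : ℝ≥0∞) (b B E : ι → Set X) (R : ι → ℝ) : Prop where
  one_le : 1 ≤ K
  ne_top : K ≠ ⊤
  measurableSet_inner : ∀ i, MeasurableSet (b i)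
  measurableSet_outer : ∀ i, MeasurableSet (B i)
  disjoint : Pairwise fun i j => Disjoint (b i) (b j)
  measure_ne_zero : ∀ i, σ (b i) ≠ 0
  measure_ne_top : ∀ i, σ (b i) ≠ ⊤
  radius_nonneg : ∀ i, 0 ≤ R i
  outer_nonempty : ∀ i, (B i).Nonempty
  outer_subset : ∀ i, B i ⊆ E i
  measure_le : ∀ i, σ (E i) ≤ K * σ (b i)
  inner_subset : ∀ i j, (B i ∩ B j).Nonempty → R i ≤ 2 * R j → b i ⊆ E j

namespace BallFamily

variable {σ : Measure X} {K : ℝ≥0∞} {b B E : ι → Set X} {R : ι → ℝ}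

/-- Vitali's lemma selects disjoint sets `B j` whose enlargements `E j` cover all `b i`. The measure
of `E j` is controlled by that of `b j`, and the integrals over the disjoint `B j` add up. -/
theorem weak_type (H : BallFamily σ K b B E R) (s : Finset ι) (h : X → ℝ≥0∞) {t : ℝ≥0∞}
    (ht : ∀ i ∈ s, t * σ (b i) ≤ ∫⁻ x in B i, h x ∂σ) :
    t * ∑ i ∈ s, σ (b i) ≤ K * ∫⁻ x, h x ∂σ := by
  classical
  obtain ⟨u, hus, hud, huc⟩ := Vitali.exists_disjoint_subfamily_covering_enlargement B
    (s : Set ι) R 2 one_lt_two (fun i _ => H.radius_nonneg i) (∑ i ∈ s, R i)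
    (fun i hi => Finset.single_le_sum (fun j _ => H.radius_nonneg j) hi)
    (fun i _ => H.outer_nonempty i)
  lift u to Finset ι using s.finite_toSet.subset hus
  have hcov : (⋃ i ∈ s, b i) ⊆ ⋃ j ∈ u, E j := by
    refine iUnion₂_subset fun i hi => ?_
    obtain ⟨j, hj, hij, hR⟩ := huc i hi
    exact (H.inner_subset i j hij hR).trans (subset_biUnion_of_mem (u := E) hj)
  calc t * ∑ i ∈ s, σ (b i) = t * σ (⋃ i ∈ s, b i) := by
        rw [measure_biUnion_finset (fun i _ j _ hij => H.disjoint hij)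
          (fun i _ => H.measurableSet_inner i)]
    _ ≤ t * ∑ j ∈ u, σ (E j) := by
        gcongr
        exact (measure_mono hcov).trans (measure_biUnion_finset_le _ _)
    _ ≤ t * ∑ j ∈ u, K * σ (b j) := by
        gcongr with j
        exact H.measure_le j
    _ = K * ∑ j ∈ u, t * σ (b j) := by
        rw [← Finset.mul_sum, ← Finset.mul_sum]; ring
    _ ≤ K * ∑ j ∈ u, ∫⁻ x in B j, h x ∂σ := by
        gcongr with j hj
        exact ht j (hus hj)
    _ = K * ∫⁻ x in ⋃ j ∈ u, B j, h x ∂σ := by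
        rw [lintegral_biUnion_finset hud (fun j _ => H.measurableSet_outer j)]
    _ ≤ K * ∫⁻ x, h x ∂σ := by
        gcongr
        exact Measure.restrict_le_self

/-- The part of `h` that is at most `t / (2K)` contributes at most `t / 2 * σ (b i)` over `B i`, so
half of the hypothesis survives for the truncated function. -/
theorem weak_type_truncated (H : BallFamily σ K b B E R) (s : Finset ι) {h : X → ℝ≥0∞}
    (hh : Measurable h) {t : ℝ≥0∞} (ht' : t ≠ ⊤)
    (ht : ∀ i ∈ s, t * σ (b i) ≤ ∫⁻ x in B i, h x ∂σ) :
    t * ∑ i ∈ s, σ (b i) ≤ 2 * K * ∫⁻ x, {x | t < 2 * K * h x}.indicator h x ∂σ := by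
  have hK0 : K ≠ 0 := (zero_lt_one.trans_le H.one_le).ne'
  have h2K : 2 * K ≠ 0 := mul_ne_zero two_ne_zero hK0
  have h2K' : 2 * K ≠ ⊤ := ENNReal.mul_ne_top ENNReal.ofNat_ne_top H.ne_top
  have hm : MeasurableSet {x | t < 2 * K * h x} :=
    measurableSet_lt measurable_const (hh.const_mul _)
  have key : ∀ i ∈ s, t / 2 * σ (b i) ≤ ∫⁻ x in B i, {x | t < 2 * K * h x}.indicator h x ∂σ := by
    intro i hi
    have h1 : ∀ x, h x ≤ {x | t < 2 * K * h x}.indicator h x + (2 * K)⁻¹ * t := by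
      intro x
      by_cases hx : t < 2 * K * h x
      · rw [indicator_of_mem (by exact hx)]
        exact le_self_add
      · rw [indicator_of_notMem (by exact hx), zero_add]
        calc h x = (2 * K)⁻¹ * (2 * K * h x) := by
              rw [← mul_assoc, ENNReal.inv_mul_cancel h2K h2K', one_mul]
          _ ≤ _ := by gcongr; exact not_lt.1 hx
    have h2 : t * σ (b i) ≤ ∫⁻ x in B i, {x | t < 2 * K * h x}.indicator h x ∂σ
        + t / 2 * σ (b i) := by
      refine (ht i hi).trans ((lintegral_mono h1).trans ?_)
      rw [lintegral_add_right _ measurable_const, setLIntegral_const]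
      refine add_le_add le_rfl ?_
      calc (2 * K)⁻¹ * t * σ (B i) ≤ (2 * K)⁻¹ * t * (K * σ (b i)) := by
            gcongr
            exact (measure_mono (H.outer_subset i)).trans (H.measure_le i)
        _ = (K⁻¹ * K) * (t / 2 * σ (b i)) := by
            rw [ENNReal.mul_inv (Or.inl two_ne_zero) (Or.inl ENNReal.ofNat_ne_top),
              ENNReal.div_eq_inv_mul]
            ring
        _ = _ := by rw [ENNReal.inv_mul_cancel hK0 H.ne_top, one_mul]
    have h3 : t * σ (b i) = t / 2 * σ (b i) + t / 2 * σ (b i) := by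
      rw [← add_mul, ENNReal.add_halves]
    rw [h3] at h2
    exact (ENNReal.add_le_add_iff_right (ENNReal.mul_ne_top
      (ENNReal.div_ne_top ht' two_ne_zero) (H.measure_ne_top i))).1 h2
  have := H.weak_type s _ key
  calc t * ∑ i ∈ s, σ (b i) = 2 * (t / 2 * ∑ i ∈ s, σ (b i)) := by
        rw [← mul_assoc, ENNReal.mul_div_cancel two_ne_zero ENNReal.ofNat_ne_top]
    _ ≤ 2 * (K * _) := by gcongr
    _ = _ := by rw [mul_assoc]

/-- The numbers `α i ^ m` act as a discrete maximal function of `f ^ m`, and this is its strong-type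
bound for the exponent `(m + 1) / m`. It comes from integrating the truncated weak-type bound over
all levels `r ^ m`. -/
theorem strong_type [SFinite σ] (H : BallFamily σ K b B E R) (s : Finset ι) {m : ℕ} (hm : m ≠ 0)
    {f : X → ℝ≥0∞} (hf : Measurable f) {α : ι → ℝ≥0∞} (hα' : ∀ i ∈ s, α i ≠ ⊤)
    (hα : ∀ i ∈ s, α i ^ m * σ (b i) = ∫⁻ x in B i, f x ^ m ∂σ) :
    ∑ i ∈ s, α i ^ (m + 1) * σ (b i) ≤ (m + 1) * (2 * K) ^ 2 * ∫⁻ x, f x ^ (m + 1) ∂σ := by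
  classical
  have h2K : 1 ≤ 2 * K := one_le_mul one_le_two H.one_le
  have h2K' : 2 * K ≠ ⊤ := ENNReal.mul_ne_top ENNReal.ofNat_ne_top H.ne_top
  have step : ∀ r ∈ Ioi (0 : ℝ), ∑ i ∈ s, {r : ℝ | ENNReal.ofReal r < α i}.indicator
      (fun r => (m + 1) * ENNReal.ofReal r ^ m) r * σ (b i) ≤
      (m + 1) * (2 * K) * ∫⁻ x, {x | ENNReal.ofReal r < 2 * K * f x}.indicator
        (fun x => f x ^ m) x ∂σ := by
    intro r hr
    have h1 : ∑ i ∈ s, {r : ℝ | ENNReal.ofReal r < α i}.indicator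
        (fun r => (m + 1) * ENNReal.ofReal r ^ m) r * σ (b i) =
        (m + 1) * (ENNReal.ofReal r ^ m *
          ∑ i ∈ s with ENNReal.ofReal r < α i, σ (b i)) := by
      rw [Finset.sum_filter, Finset.mul_sum, Finset.mul_sum]
      refine Finset.sum_congr rfl fun i _ => ?_
      by_cases h : ENNReal.ofReal r < α i
      · simp [indicator, h, mul_assoc]
      · simp [indicator, h]
    have h2 := H.weak_type_truncated {i ∈ s | ENNReal.ofReal r < α i} (hf.pow_const m)
      (t := ENNReal.ofReal r ^ m) (ENNReal.pow_ne_top ENNReal.ofReal_ne_top) (fun i hi => by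
        rw [Finset.mem_filter] at hi
        rw [← hα i hi.1]
        gcongr
        exact hi.2.le)
    rw [h1, mul_assoc _ (2 * K)]
    refine mul_le_mul' le_rfl (h2.trans (mul_le_mul' le_rfl (lintegral_mono fun x => ?_)))
    refine indicator_le_indicator_of_subset (fun x hx => ?_) (fun _ => zero_le) x
    have hx' : ENNReal.ofReal r ^ m < 2 * K * f x ^ m := hx
    -- As `2 * K ≥ 1`, it is at most its `m`-th power; the truncation of `f ^ m` at level `r ^ m`
    -- thus becomes one of `f` at level `r`.
    have : ENNReal.ofReal r ^ m < (2 * K * f x) ^ m := by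
      refine hx'.trans_le ?_
      rw [mul_pow]
      gcongr
      exact le_self_pow h2K hm
    exact lt_of_not_ge fun h => this.not_ge (pow_le_pow_left' h m)
  have hmeas : ∀ i, Measurable ({r : ℝ | ENNReal.ofReal r < α i}.indicator
      (fun r => ((m : ℝ≥0∞) + 1) * ENNReal.ofReal r ^ m)) := fun i =>
    ((ENNReal.measurable_ofReal.pow_const m).const_mul _).indicator
      (measurableSet_lt ENNReal.measurable_ofReal measurable_const)
  calc ∑ i ∈ s, α i ^ (m + 1) * σ (b i)
      = ∫⁻ r in Ioi (0 : ℝ), ∑ i ∈ s, {r : ℝ | ENNReal.ofReal r < α i}.indicator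
          (fun r => (m + 1) * ENNReal.ofReal r ^ m) r * σ (b i) := by
        rw [lintegral_finsetSum _ fun i _ => (hmeas i).mul_const _]
        refine Finset.sum_congr rfl fun i hi => ?_
        rw [lintegral_mul_const _ (hmeas i), lintegral_pow_layer m (hα' i hi)]
    _ ≤ ∫⁻ r in Ioi (0 : ℝ), (m + 1) * (2 * K) *
          ∫⁻ x, {x | ENNReal.ofReal r < 2 * K * f x}.indicator (fun x => f x ^ m) x ∂σ :=
        setLIntegral_mono' measurableSet_Ioi step
    _ = (m + 1) * (2 * K) * ∫⁻ x, (∫⁻ r in Ioi (0 : ℝ),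
          {x | ENNReal.ofReal r < 2 * K * f x}.indicator (fun x => f x ^ m) x) ∂σ := by
        rw [lintegral_const_mul' _ _ (by finiteness), lintegral_lintegral_swap]
        refine Measurable.aemeasurable ?_
        have : (Function.uncurry fun (r : ℝ) (x : X) =>
            {x | ENNReal.ofReal r < 2 * K * f x}.indicator (fun x => f x ^ m) x) =
            {p : ℝ × X | ENNReal.ofReal p.1 < 2 * K * f p.2}.indicator (fun p => f p.2 ^ m) := rfl
        rw [this]
        exact ((hf.comp measurable_snd).pow_const m).indicator
          (measurableSet_lt (ENNReal.measurable_ofReal.comp measurable_fst)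
            ((hf.comp measurable_snd).const_mul _))
    _ ≤ (m + 1) * (2 * K) * ∫⁻ x, (2 * K) * f x ^ (m + 1) ∂σ := by
        gcongr with x
        have hset : ∀ a : ℝ≥0∞, volume ({r : ℝ | ENNReal.ofReal r < a} ∩ Ioi 0) ≤ a := by
          intro a
          by_cases ha : a = ⊤
          · simp [ha]
          calc volume ({r : ℝ | ENNReal.ofReal r < a} ∩ Ioi 0)
              ≤ volume (Ioo 0 a.toReal) := by
                refine measure_mono fun r hr => ⟨hr.2, ?_⟩
                exact (ENNReal.ofReal_lt_iff_lt_toReal (le_of_lt hr.2) ha).1 hr.1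
            _ = a := by simp [ha]
        calc ∫⁻ r in Ioi (0 : ℝ),
              {x | ENNReal.ofReal r < 2 * K * f x}.indicator (fun x => f x ^ m) x
            = ∫⁻ r in Ioi (0 : ℝ),
              {r : ℝ | ENNReal.ofReal r < 2 * K * f x}.indicator (fun _ => f x ^ m) r := rfl
          _ = f x ^ m * volume ({r : ℝ | ENNReal.ofReal r < 2 * K * f x} ∩ Ioi 0) := by
              have hms : MeasurableSet {r : ℝ | ENNReal.ofReal r < 2 * K * f x} :=
                measurableSet_lt ENNReal.measurable_ofReal measurable_const
              rw [lintegral_indicator_const hms, Measure.restrict_apply hms]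
          _ ≤ f x ^ m * (2 * K * f x) := by gcongr; exact hset _
          _ = 2 * K * f x ^ (m + 1) := by ring
    _ = _ := by
        rw [lintegral_const_mul' _ _ h2K']
        ring

/-- Expanding one factor of `f ^ (m + 1)` turns the integral into the sum of `c i * α i ^ m * σ (b
i)`. Young's inequality splits off the wanted sum, and by `strong_type` the rest is at most half of
the original integral. The constant `L` is twice the strong-type constant for this purpose. -/
theorem lintegral_sum_pow_le [SFinite σ] (H : BallFamily σ K b B E R) (s : Finset ι) {m : ℕ}
    (hm : m ≠ 0) {c : ι → ℝ≥0∞} (hc : ∀ i, c i ≠ ⊤) :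
    ∫⁻ x, (∑ i ∈ s, c i * (B i).indicator 1 x) ^ (m + 1) ∂σ ≤
      2 * (2 * ((m + 1) * (2 * K) ^ 2)) ^ m * ∑ i ∈ s, c i ^ (m + 1) * σ (b i) := by
  set f : X → ℝ≥0∞ := fun x => ∑ i ∈ s, c i * (B i).indicator 1 x with hfdef
  set L : ℝ≥0∞ := 2 * ((m + 1) * (2 * K) ^ 2) with hLdef
  have hKt := H.ne_top
  have hK0 : K ≠ 0 := (zero_lt_one.trans_le H.one_le).ne'
  have hQ0 : ((m : ℝ≥0∞) + 1) * (2 * K) ^ 2 ≠ 0 := by simp [hK0]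
  have hQt : ((m : ℝ≥0∞) + 1) * (2 * K) ^ 2 ≠ ⊤ := by finiteness
  have hL0 : L ≠ 0 := mul_ne_zero two_ne_zero hQ0
  have hLt : L ≠ ⊤ := by finiteness
  have hf : Measurable f :=
    Finset.measurable_fun_sum _ fun i _ =>
      (measurable_one.indicator (H.measurableSet_outer i)).const_mul _
  have hBt : ∀ i, σ (B i) ≠ ⊤ := fun i => ne_top_of_le_ne_top
    (ENNReal.mul_ne_top hKt (H.measure_ne_top i))
    ((measure_mono (H.outer_subset i)).trans (H.measure_le i))
  have hfb : ∀ x, f x ≤ ∑ i ∈ s, c i := fun x => Finset.sum_le_sum fun i _ => by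
    calc c i * (B i).indicator 1 x ≤ c i * 1 := by
          gcongr
          exact indicator_le_self' (fun _ _ => zero_le) x
      _ = c i := mul_one _
  have hct : ∑ i ∈ s, c i ≠ ⊤ := ENNReal.sum_ne_top.2 fun i _ => hc i
  -- Absorbing half of the integral into the left-hand side requires it to be finite; this is why
  -- the sum is finite here.
  have hfin : ∫⁻ x, f x ^ (m + 1) ∂σ ≠ ⊤ := by
    have h1 : ∀ x, f x ^ (m + 1) ≤ ∑ i ∈ s, (∑ i ∈ s, c i) ^ m * c i * (B i).indicator 1 x := by
      intro x
      rw [pow_succ, hfdef, Finset.mul_sum]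
      refine Finset.sum_le_sum fun i _ => ?_
      rw [mul_assoc]
      gcongr
      exact hfb x
    refine ne_top_of_le_ne_top ?_ (lintegral_mono h1)
    rw [lintegral_finsetSum _ fun i _ =>
      (measurable_one.indicator (H.measurableSet_outer i)).const_mul _]
    refine ENNReal.sum_ne_top.2 fun i _ => ?_
    rw [lintegral_const_mul _ (measurable_one.indicator (H.measurableSet_outer i)),
      lintegral_indicator_one (H.measurableSet_outer i)]
    have := hBt i
    have := hc i
    finiteness
  have hαex : ∀ i, ∃ a : ℝ≥0∞, a ≠ ⊤ ∧ a ^ m * σ (b i) = ∫⁻ x in B i, f x ^ m ∂σ := by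
    intro i
    have hI : ∫⁻ x in B i, f x ^ m ∂σ ≠ ⊤ := by
      refine ne_top_of_le_ne_top ?_ (lintegral_mono fun x => pow_le_pow_left' (hfb x) m)
      rw [setLIntegral_const]
      have := hBt i
      finiteness
    have hm' : (0 : ℝ) ≤ (m : ℝ)⁻¹ := by positivity
    refine ⟨((∫⁻ x in B i, f x ^ m ∂σ) / σ (b i)) ^ (m : ℝ)⁻¹,
      ENNReal.rpow_ne_top_of_nonneg hm' (ENNReal.div_ne_top hI (H.measure_ne_zero i)), ?_⟩
    rw [ENNReal.rpow_inv_natCast_pow hm,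
      ENNReal.div_mul_cancel (H.measure_ne_zero i) (H.measure_ne_top i)]
  choose α hαt hα using hαex
  have hstrong := H.strong_type s hm hf (fun i _ => hαt i) (fun i _ => hα i)
  have hmain : ∫⁻ x, f x ^ (m + 1) ∂σ ≤ L ^ m * ∑ i ∈ s, c i ^ (m + 1) * σ (b i) +
      2⁻¹ * ∫⁻ x, f x ^ (m + 1) ∂σ := by
    calc ∫⁻ x, f x ^ (m + 1) ∂σ = ∫⁻ x, ∑ i ∈ s, c i * (B i).indicator (fun x => f x ^ m) x ∂σ := by
          refine lintegral_congr fun x => ?_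
          rw [pow_succ', hfdef, Finset.sum_mul]
          refine Finset.sum_congr rfl fun i _ => ?_
          by_cases hx : x ∈ B i <;> simp [hx]
      _ = ∑ i ∈ s, c i * (α i ^ m * σ (b i)) := by
          rw [lintegral_finsetSum _ fun i _ =>
            ((hf.pow_const m).indicator (H.measurableSet_outer i)).const_mul _]
          refine Finset.sum_congr rfl fun i _ => ?_
          rw [lintegral_const_mul _ ((hf.pow_const m).indicator (H.measurableSet_outer i)),
            lintegral_indicator (H.measurableSet_outer i), hα i]
      _ ≤ ∑ i ∈ s, (L ^ m * (c i ^ (m + 1) * σ (b i)) + L⁻¹ * (α i ^ (m + 1) * σ (b i))) := by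
          refine Finset.sum_le_sum fun i _ => ?_
          rw [← mul_assoc, ← mul_assoc (L ^ m), ← mul_assoc L⁻¹, ← add_mul]
          gcongr
          exact mul_pow_le_add m _ _ hL0 hLt
      _ = L ^ m * ∑ i ∈ s, c i ^ (m + 1) * σ (b i) + L⁻¹ * ∑ i ∈ s, α i ^ (m + 1) * σ (b i) := by
          rw [Finset.sum_add_distrib, Finset.mul_sum, Finset.mul_sum]
      _ ≤ L ^ m * ∑ i ∈ s, c i ^ (m + 1) * σ (b i) +
          L⁻¹ * ((m + 1) * (2 * K) ^ 2 * ∫⁻ x, f x ^ (m + 1) ∂σ) := by gcongr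
      _ = _ := by
          congr 1
          rw [hLdef, ENNReal.mul_inv (Or.inl two_ne_zero) (Or.inl ENNReal.ofNat_ne_top),
            ← mul_assoc, mul_assoc 2⁻¹, ENNReal.inv_mul_cancel hQ0 hQt, mul_one]
  have hhalf : 2⁻¹ * ∫⁻ x, f x ^ (m + 1) ∂σ ≤ L ^ m * ∑ i ∈ s, c i ^ (m + 1) * σ (b i) := by
    have h2 : 2⁻¹ * ∫⁻ x, f x ^ (m + 1) ∂σ ≠ ⊤ := by finiteness
    refine (ENNReal.add_le_add_iff_right h2).1 (le_trans (le_of_eq ?_) hmain)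
    rw [← add_mul, ENNReal.inv_two_add_inv_two, one_mul]
  calc ∫⁻ x, f x ^ (m + 1) ∂σ = 2 * (2⁻¹ * ∫⁻ x, f x ^ (m + 1) ∂σ) := by
        rw [← mul_assoc, ENNReal.mul_inv_cancel two_ne_zero ENNReal.ofNat_ne_top, one_mul]
    _ ≤ 2 * (L ^ m * ∑ i ∈ s, c i ^ (m + 1) * σ (b i)) := by gcongr
    _ = _ := by rw [mul_assoc]

/-- Bojarski's lemma: the `Lᵖ` norm of `∑ c i 1_{B i}` is controlled by that of `∑ c i 1_{b i}`. -/
theorem lintegral_tsum_pow_le [Countable ι] [SFinite σ] (H : BallFamily σ K b B E R) {m : ℕ}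
    (hm : m ≠ 0) {c : ι → ℝ≥0∞} (hc : ∀ i, c i ≠ ⊤) :
    ∫⁻ x, (∑' i, c i * (B i).indicator 1 x) ^ (m + 1) ∂σ ≤
      2 * (2 * ((m + 1) * (2 * K) ^ 2)) ^ m * ∑' i, c i ^ (m + 1) * σ (b i) := by
  classical
  simp_rw [ENNReal.tsum_eq_iSup_sum, ENNReal.iSup_pow]
  rw [lintegral_iSup_directed]
  · refine iSup_le fun s => (H.lintegral_sum_pow_le s hm hc).trans ?_
    gcongr
    exact le_iSup (fun s : Finset ι => ∑ i ∈ s, c i ^ (m + 1) * σ (b i)) s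
  · intro s
    exact ((Finset.measurable_fun_sum _ fun i _ =>
      (measurable_one.indicator (H.measurableSet_outer i)).const_mul _).pow_const _).aemeasurable
  · refine directed_of_isDirected_le fun s t hst x => ?_
    dsimp only
    gcongr

end BallFamily

end SumOfBalls

/-! ### Charts of a Riemannian manifold are locally bi-Lipschitz. -/

section ChartBilipschitz

open Filter Topology Manifold

variable {E : Type*} [NormedAddCommGroup E] [NormedSpace ℝ E]
  {H : Type*} [TopologicalSpace H] {I : ModelWithCorners ℝ E H}
  {M : Type*} [EMetricSpace M] [ChartedSpace H M]
  [RiemannianBundle (fun x : M => TangentSpace I x)]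
  [IsManifold I 1 M] [IsContinuousRiemannianBundle E (fun x : M => TangentSpace I x)]
  [IsRiemannianManifold I M]

attribute [local instance] normedAddCommGroupTangentSpaceVectorSpace
  normedSpaceTangentSpaceVectorSpace

variable (I) in
-- The inverse chart has bounded derivative near the center. The segment from `u` to `v` stays in
-- the convex set `ball ∩ range I`, and its image is a path of length at most `C` times the distance
-- of `u` and `v`.
theorem exists_lipschitzOnWith_extChartAt_symm (x : M) :
    ∃ (C : ℝ≥0) (r : ℝ), 0 < r ∧
      Metric.ball (extChartAt I x x) r ∩ range I ⊆ (extChartAt I x).target ∧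
      LipschitzOnWith C (extChartAt I x).symm (Metric.ball (extChartAt I x x) r ∩ range I) := by
  obtain ⟨C, C_pos, hC⟩ := eventually_enorm_mfderivWithin_symm_extChartAt_lt I x
  obtain ⟨r, r_pos, hr⟩ := Metric.mem_nhdsWithin_iff.1
    (inter_mem (extChartAt_target_mem_nhdsWithin x) hC)
  refine ⟨C, r, r_pos, hr.trans inter_subset_left, fun u hu v hv => ?_⟩
  let η := ContinuousAffineMap.lineMap (R := ℝ) u v
  set γ := (extChartAt I x).symm ∘ η
  have hη : Icc 0 1 ⊆ ⇑η ⁻¹' (Metric.ball (extChartAt I x x) r ∩ range I) := by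
    simp only [← image_subset_iff, ContinuousAffineMap.coe_lineMap_eq,
     ← segment_eq_image_lineMap, η]
    exact ((convex_ball _ _).inter I.convex_range).segment_subset hu hv
  replace hη := hη.trans (preimage_mono hr)
  simp only [preimage_inter, subset_inter_iff] at hη
  have η_smooth : CMDiff[Icc 0 1] 1 η := by
    apply ContMDiff.contMDiffOn
    rw [contMDiff_iff_contDiff]
    exact ContinuousAffineMap.contDiff _
  have hle : edist ((extChartAt I x).symm u) ((extChartAt I x).symm v) ≤
      pathELength I γ 0 1 := by
    rw [IsRiemannianManifold.out (I := I)]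
    apply riemannianEDist_le_pathELength _ _ _ zero_le_one
    · exact (contMDiffOn_extChartAt_symm x).comp η_smooth hη.1
    · simp [γ, η, ContinuousAffineMap.coe_lineMap_eq]
    · simp [γ, η, ContinuousAffineMap.coe_lineMap_eq]
  apply hle.trans
  rw [← lintegral_fderiv_lineMap_eq_edist, pathELength_eq_lintegral_mfderivWithin_Icc,
    ← lintegral_const_mul' _ _ ENNReal.coe_ne_top]
  apply setLIntegral_mono' measurableSet_Icc (fun t ht ↦ ?_)
  have hcomp : mfderiv[Icc 0 1] γ t =
      (mfderiv[range I] (extChartAt I x).symm (η t)) ∘L (mfderiv[Icc 0 1] η t) := by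
    apply mfderivWithin_comp
    · exact mdifferentiableWithinAt_extChartAt_symm (hη.1 ht)
    · exact η_smooth.mdifferentiableOn one_ne_zero t ht
    · exact hη.1.trans (preimage_mono (extChartAt_target_subset_range x))
    · rw [uniqueMDiffWithinAt_iff_uniqueDiffWithinAt]
      exact uniqueDiffOn_Icc zero_lt_one t ht
  have hval : mfderiv[Icc 0 1] γ t 1 =
      (mfderiv[range I] (extChartAt I x).symm (η t)) (mfderiv[Icc 0 1] η t 1) := congr($hcomp 1)
  rw [hval]
  apply (ContinuousLinearMap.le_opENorm _ _).trans
  gcongr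
  · exact (hη.2 ht).le
  · simp only [mfderivWithin_eq_fderivWithin]
    exact le_of_eq rfl

variable (I) in
-- Nearly shortest paths are mapped by the chart to paths at most `C` times as long. Between points
-- of `B(x, δ)` such a path has length less than `2δ`, so it stays in `B(x, 3δ)`, where the
-- derivative bound holds.
theorem exists_lipschitzOnWith_extChartAt (x : M) :
    ∃ (C : ℝ≥0) (δ : ℝ≥0), 0 < δ ∧ Metric.eball x δ ⊆ (extChartAt I x).source ∧
      LipschitzOnWith C (extChartAt I x) (Metric.eball x δ) := by
  obtain ⟨C, C_pos, hC⟩ := eventually_enorm_mfderiv_extChartAt_lt I x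
  obtain ⟨ε, ε_pos, hε⟩ := EMetric.mem_nhds_iff.1
    (Filter.inter_mem (extChartAt_source_mem_nhds (I := I) x) hC)
  obtain ⟨δ, δ_pos, hδ⟩ : ∃ δ : ℝ≥0, 0 < δ ∧ (3 * δ : ℝ≥0∞) ≤ ε := by
    obtain ⟨δ, h0, h⟩ := ENNReal.exists_nnreal_pos_mul_lt (ENNReal.ofNat_ne_top (n := 3)) ε_pos.ne'
    exact ⟨δ, h0, by rw [mul_comm]; exact h.le⟩
  have hδε : (δ : ℝ≥0∞) ≤ ε := le_trans (by
    calc (δ : ℝ≥0∞) = 1 * δ := (one_mul _).symm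
      _ ≤ 3 * δ := by gcongr; norm_num) hδ
  refine ⟨C, δ, δ_pos, fun y hy => (hε (Metric.eball_subset_eball hδε hy)).1, fun y hy z hz => ?_⟩
  have hyz : edist y z < 2 * δ := by
    rw [two_mul]
    exact (edist_triangle_right y z x).trans_lt (ENNReal.add_lt_add hy hz)
  have key : ∀ r, edist y z < r → r ≤ 2 * δ →
      edist (extChartAt I x y) (extChartAt I x z) ≤ C * r := by
    intro r hr hrδ
    rw [IsRiemannianManifold.out (I := I)] at hr
    obtain ⟨γ, hγy, hγz, γ_smooth, hγ, -⟩ :=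
      exists_lt_locally_constant_of_riemannianEDist_lt hr zero_lt_one
    have hmem := fun t (ht : t ∈ Icc (0 : ℝ) 1) => @hε (γ t) <| by
      have h1 : edist y (γ t) ≤ pathELength I γ 0 1 := by
        rw [IsRiemannianManifold.out (I := I)]
        exact (riemannianEDist_le_pathELength γ_smooth.contMDiffOn hγy rfl ht.1).trans
          (pathELength_mono le_rfl ht.2)
      refine lt_of_lt_of_le ?_ hδ
      calc edist (γ t) x ≤ edist y (γ t) + edist y x := by
            rw [edist_comm y]; exact edist_triangle _ _ _
        _ < 2 * δ + δ := ENNReal.add_lt_add ((h1.trans_lt hγ).trans_le hrδ) hy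
        _ = 3 * δ := by ring
    have hsrc : ∀ t ∈ Icc (0 : ℝ) 1, γ t ∈ (chartAt H x).source := fun t ht => by
      simpa [extChartAt_source I x] using (hmem t ht).1
    let γ' := extChartAt I x ∘ γ
    have hsm : CMDiff[Icc 0 1] 1 γ' :=
      contMDiffOn_extChartAt.comp (I' := I) (t := (chartAt H x).source)
        γ_smooth.contMDiffOn hsrc
    have : ‖γ' 1 - γ' 0‖ₑ ≤ C * r := by
      calc
        ‖γ' 1 - γ' 0‖ₑ
      _ ≤ ∫⁻ t' in Icc 0 1, ‖derivWithin γ' (Icc 0 1) t'‖ₑ := by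
        apply enorm_sub_le_lintegral_derivWithin_Icc_of_contDiffOn_Icc _ zero_le_one
        rwa [← contMDiffOn_iff_contDiffOn]
      _ = ∫⁻ t' in Icc 0 1, ‖mfderiv[Icc 0 1] γ' t' 1‖ₑ := by
        simp_rw [← fderivWithin_derivWithin, mfderivWithin_eq_fderivWithin]
        rfl
      _ ≤ ∫⁻ t' in Icc 0 1, C * ‖mfderiv[Icc 0 1] γ t' 1‖ₑ := by
        apply setLIntegral_mono' measurableSet_Icc (fun t' ht' ↦ ?_)
        have hcomp : mfderiv[Icc 0 1] γ' t' =
            (mfderiv% (extChartAt I x) (γ t')) ∘L (mfderiv[Icc 0 1] γ t') := by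
          apply mfderiv_comp_mfderivWithin
          · exact mdifferentiableAt_extChartAt (hsrc t' ht')
          · exact (γ_smooth.mdifferentiable one_ne_zero).mdifferentiableOn _ ht'
          · rw [uniqueMDiffWithinAt_iff_uniqueDiffWithinAt]
            exact uniqueDiffOn_Icc zero_lt_one _ ht'
        have hval : mfderiv[Icc 0 1] γ' t' 1 =
            (mfderiv% (extChartAt I x) (γ t')) (mfderiv[Icc 0 1] γ t' 1) :=
          congr($hcomp 1)
        rw [hval]
        apply (ContinuousLinearMap.le_opENorm _ _).trans
        gcongr
        exact (hmem t' ht').2.le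
      _ = C * pathELength I γ 0 1 := by
        rw [lintegral_const_mul' _ _ ENNReal.coe_ne_top,
            pathELength_eq_lintegral_mfderivWithin_Icc]
      _ ≤ C * r := by gcongr
    rw [edist_comm, edist_eq_enorm_sub]
    simpa [γ', hγy, hγz] using this
  have hC0 : (C : ℝ≥0∞) ≠ 0 := by exact_mod_cast C_pos.ne'
  rw [mul_comm, ← ENNReal.div_le_iff_le_mul (Or.inl hC0) (Or.inl ENNReal.coe_ne_top)]
  -- Let `r` decrease to the distance of `y` and `z`; the minimum with `2 * δ` keeps the path in the
  -- region of control.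
  refine le_of_forall_gt_imp_ge_of_dense fun r hr => ?_
  refine le_trans ?_ (min_le_left r (2 * δ))
  rw [ENNReal.div_le_iff_le_mul (Or.inl hC0) (Or.inl ENNReal.coe_ne_top), mul_comm]
  exact key _ (lt_min hr hyz) (min_le_right _ _)

end ChartBilipschitz

/-! ### Volume under Lipschitz maps. -/

section Volume

variable {X Y : Type*} [EMetricSpace X] [MeasurableSpace X] [BorelSpace X]
  [EMetricSpace Y] [MeasurableSpace Y] [BorelSpace Y]

theorem _root_.LipschitzOnWith.riemannianVolume_image_le {K : ℝ≥0} {f : X → Y} {s : Set X}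
    (h : LipschitzOnWith K f s) (n : ℕ) :
    riemannianVolume n (f '' s) ≤ (K : ℝ≥0∞) ^ n * riemannianVolume n s := by
  rw [riemannianVolume, riemannianVolume, Measure.euclideanHausdorffMeasure_def,
    Measure.euclideanHausdorffMeasure_def, Measure.smul_apply, Measure.smul_apply]
  have := h.hausdorffMeasure_image_le (Nat.cast_nonneg n)
  rw [ENNReal.rpow_natCast] at this
  rw [ENNReal.smul_def, ENNReal.smul_def, smul_eq_mul, smul_eq_mul, mul_left_comm]
  gcongr

end Volume

/-! ### Volume of small balls, first near a point and then near a compact set. -/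

section RiemannianVolume

variable {n : ℕ} {M : Type*} [EMetricSpace M] [ChartedSpace (EuclideanSpace ℝ (Fin n)) M]
  [IsManifold (𝓡 n) 1 M] [RiemannianBundle (fun x : M => TangentSpace (𝓡 n) x)]
  [IsContinuousRiemannianBundle (EuclideanSpace ℝ (Fin n)) (fun x : M => TangentSpace (𝓡 n) x)]
  [IsRiemannianManifold (𝓡 n) M] [MeasurableSpace M] [BorelSpace M]

variable (n) in
/-- Small balls of a Riemannian manifold have volume comparable to the `n`-th power of the radius,
locally uniformly. -/
theorem exists_riemannianVolume_eball (x₀ : M) :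
    ∃ (K : ℝ≥0∞) (δ : ℝ), K ≠ ⊤ ∧ 0 < δ ∧
      ∀ x ∈ Metric.eball x₀ (ENNReal.ofReal δ), ∀ r, 0 < r → r ≤ δ →
      riemannianVolume n (Metric.eball x (ENNReal.ofReal r)) ≤ K * ENNReal.ofReal r ^ n ∧
      ENNReal.ofReal r ^ n ≤ K * riemannianVolume n (Metric.eball x (ENNReal.ofReal r)) := by
  obtain ⟨C₁, ρ, hρ, hsub, hl₁⟩ := exists_lipschitzOnWith_extChartAt_symm (𝓡 n) x₀
  obtain ⟨C₂, ε, hε, hsrc, hl₂⟩ := exists_lipschitzOnWith_extChartAt (𝓡 n) x₀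
  set φ := extChartAt (𝓡 n) x₀ with hφ
  rw [(𝓡 n).range_eq_univ, inter_univ] at hsub hl₁
  obtain ⟨C, hC1, hC⟩ : ∃ C : ℝ≥0, 1 ≤ C ∧ C₁ ≤ C ∧ C₂ ≤ C :=
    ⟨max 1 (max C₁ C₂), by simp, by simp, by simp⟩
  replace hl₁ := hl₁.weaken hC.1
  replace hl₂ := hl₂.weaken hC.2
  have hC0 : (0 : ℝ) < C := lt_of_lt_of_le zero_lt_one hC1
  set V : ℝ≥0∞ := volume (Metric.ball (0 : EuclideanSpace ℝ (Fin n)) 1) with hV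
  have hV0 : V ≠ 0 := (Metric.measure_ball_pos volume _ one_pos).ne'
  have hVt : V ≠ ⊤ := measure_ball_lt_top.ne
  have hvol : ∀ (y : EuclideanSpace ℝ (Fin n)) (r : ℝ), 0 < r →
      riemannianVolume n (Metric.eball y (ENNReal.ofReal r)) = ENNReal.ofReal r ^ n * V := by
    intro y r hr
    rw [riemannianVolume, EuclideanSpace.euclideanHausdorffMeasure_eq_volume, Metric.eball_ofReal,
      Measure.addHaar_ball_of_pos _ _ hr, finrank_euclideanSpace_fin, ENNReal.ofReal_pow hr.le]
  -- Balls of radius at most `δ` centered within `δ` of `x₀` lie in `B(x₀, 2δ)`. The choice of `δ`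
  -- puts this in the domain of `hl₂` and, as `2Cδ < ρ`, its image in that of `hl₁`.
  have hδ : 0 < min ((ε : ℝ) / 2) (ρ / (4 * C)) := by
    have : (0 : ℝ) < ε := hε
    positivity
  refine ⟨C ^ n * (C ^ n * V) + C ^ n * C ^ n * V⁻¹, min ((ε : ℝ) / 2) (ρ / (4 * C)), ?_, hδ, ?_⟩
  · finiteness
  generalize hδdef : min ((ε : ℝ) / 2) (ρ / (4 * C)) = δ at hδ
  intro x hx r hr hrδ
  have h1 : 2 * δ ≤ ε := by
    have : δ ≤ ε / 2 := hδdef ▸ min_le_left _ _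
    linarith
  have h2 : C * (2 * δ) < ρ := by
    have : δ ≤ ρ / (4 * C) := hδdef ▸ min_le_right _ _
    rw [le_div_iff₀ (by positivity)] at this
    linarith
  have hxε : Metric.eball x (ENNReal.ofReal r) ⊆ Metric.eball x₀ (ENNReal.ofReal (2 * δ)) := by
    intro y hy
    rw [two_mul, ENNReal.ofReal_add hδ.le hδ.le]
    exact (edist_triangle y x x₀).trans_lt
      (ENNReal.add_lt_add (hy.trans_le (ENNReal.ofReal_le_ofReal hrδ)) hx)
  have hεsub : Metric.eball x₀ (ENNReal.ofReal (2 * δ)) ⊆ Metric.eball x₀ ε :=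
    Metric.eball_subset_eball (by
      rw [← ENNReal.ofReal_coe_nnreal]
      exact ENNReal.ofReal_le_ofReal h1)
  have hx' : x ∈ Metric.eball x₀ ε := hεsub (hxε (Metric.mem_eball_self (ENNReal.ofReal_pos.2 hr)))
  have hlip : ∀ y ∈ Metric.eball x₀ (ε : ℝ≥0∞), ∀ z ∈ Metric.eball x₀ (ε : ℝ≥0∞), ∀ s : ℝ,
      y ∈ Metric.eball z (ENNReal.ofReal s) →
      φ y ∈ Metric.eball (φ z) (ENNReal.ofReal (C * s)) := by
    intro y hy z hz s hyz
    rw [ENNReal.ofReal_mul C.coe_nonneg, ENNReal.ofReal_coe_nnreal]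
    refine (hl₂ hy hz).trans_lt ?_
    exact ENNReal.mul_lt_mul_right (by exact_mod_cast hC0.ne') ENNReal.coe_ne_top hyz
  have hx₀ : x₀ ∈ Metric.eball x₀ (ε : ℝ≥0∞) := Metric.mem_eball_self (by exact_mod_cast hε)
  have himg : φ '' Metric.eball x (ENNReal.ofReal r) ⊆ Metric.ball (φ x₀) ρ := by
    rintro _ ⟨y, hy, rfl⟩
    have := hlip y (hεsub (hxε hy)) x₀ hx₀ _ (hxε hy)
    rw [Metric.eball_ofReal] at this
    exact Metric.ball_subset_ball h2.le this
  constructor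
  · have hsymm : Metric.eball x (ENNReal.ofReal r) ⊆
        φ.symm '' (φ '' Metric.eball x (ENNReal.ofReal r)) := by
      intro y hy
      exact ⟨φ y, ⟨y, hy, rfl⟩, φ.left_inv (hsrc (hεsub (hxε hy)))⟩
    calc riemannianVolume n (Metric.eball x (ENNReal.ofReal r))
        ≤ riemannianVolume n (φ.symm '' (φ '' Metric.eball x (ENNReal.ofReal r))) :=
          measure_mono hsymm
      _ ≤ C ^ n * riemannianVolume n (φ '' Metric.eball x (ENNReal.ofReal r)) :=
          (hl₁.mono himg).riemannianVolume_image_le n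
      _ ≤ C ^ n * riemannianVolume n (Metric.eball (φ x) (ENNReal.ofReal (C * r))) := by
          gcongr
          rintro _ ⟨y, hy, rfl⟩
          exact hlip y (hεsub (hxε hy)) x hx' _ hy
      _ = C ^ n * (C ^ n * V) * ENNReal.ofReal r ^ n := by
          rw [hvol _ _ (by positivity), ENNReal.ofReal_mul C.coe_nonneg, ENNReal.ofReal_coe_nnreal]
          ring
      _ ≤ _ := by
          gcongr
          exact le_self_add
  -- The inverse chart is `C`-Lipschitz, so the image of `B(x, r)` contains the Euclidean ball of
  -- radius `r / C`, whose volume is explicit.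
  · have hsub' : Metric.eball (φ x) (ENNReal.ofReal (r / C)) ⊆
        φ '' Metric.eball x (ENNReal.ofReal r) := by
      have hφx : φ x ∈ Metric.ball (φ x₀) ρ :=
        himg ⟨x, Metric.mem_eball_self (ENNReal.ofReal_pos.2 hr), rfl⟩
      intro u hu
      have huρ : u ∈ Metric.ball (φ x₀) ρ := by
        have h3 := hlip x hx' x₀ hx₀ δ hx
        rw [Metric.eball_ofReal] at h3 hu
        have h4 : r / C ≤ C * δ := by
          calc r / C ≤ r := div_le_self hr.le hC1
            _ ≤ δ := hrδ
            _ ≤ C * δ := le_mul_of_one_le_left hδ.le hC1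
        rw [Metric.mem_ball] at h3 hu ⊢
        calc dist u (φ x₀) ≤ dist u (φ x) + dist (φ x) (φ x₀) := dist_triangle _ _ _
          _ < ρ := by linarith
      refine ⟨φ.symm u, ?_, φ.right_inv (hsub huρ)⟩
      have h5 := hl₁ huρ hφx
      rw [φ.left_inv (hsrc hx')] at h5
      refine h5.trans_lt ?_
      have h6 : ENNReal.ofReal r = C * ENNReal.ofReal (r / C) := by
        rw [← ENNReal.ofReal_coe_nnreal, ← ENNReal.ofReal_mul C.coe_nonneg,
          mul_div_cancel₀ _ hC0.ne']
      rw [h6]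
      exact ENNReal.mul_lt_mul_right (by exact_mod_cast hC0.ne') ENNReal.coe_ne_top hu
    have h7 : ENNReal.ofReal (r / C) ^ n * V ≤
        C ^ n * riemannianVolume n (Metric.eball x (ENNReal.ofReal r)) := by
      rw [← hvol (φ x) _ (by positivity)]
      exact (measure_mono hsub').trans
        ((hl₂.mono (hxε.trans hεsub)).riemannianVolume_image_le n)
    calc ENNReal.ofReal r ^ n = C ^ n * V⁻¹ * (ENNReal.ofReal (r / C) ^ n * V) := by
          have h8 : ENNReal.ofReal r = C * ENNReal.ofReal (r / C) := by
            rw [← ENNReal.ofReal_coe_nnreal, ← ENNReal.ofReal_mul C.coe_nonneg,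
              mul_div_cancel₀ _ hC0.ne']
          rw [h8, mul_pow]
          calc _ = C ^ n * ENNReal.ofReal (r / C) ^ n * (V⁻¹ * V) := by
                rw [ENNReal.inv_mul_cancel hV0 hVt, mul_one]
            _ = _ := by ring
      _ ≤ C ^ n * V⁻¹ * (C ^ n * riemannianVolume n (Metric.eball x (ENNReal.ofReal r))) := by
          gcongr
      _ = C ^ n * C ^ n * V⁻¹ * riemannianVolume n (Metric.eball x (ENNReal.ofReal r)) := by ring
      _ ≤ _ := by
          gcongr
          exact le_add_self

end RiemannianVolume

section Regular

variable {M : Type*} [EMetricSpace M] [MeasurableSpace M] [BorelSpace M]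

/-- The volume of balls of radius `r ≤ δ` with center in the `δ`-neighborhood of `Λ` is comparable
to `rⁿ`. -/
def RegularNear (n : ℕ) (Λ : Set M) (K : ℝ≥0∞) (δ : ℝ) : Prop :=
  ∀ x ∈ Metric.thickening δ Λ, ∀ r, 0 < r → r ≤ δ →
    riemannianVolume n (Metric.eball x (ENNReal.ofReal r)) ≤ K * ENNReal.ofReal r ^ n ∧
    ENNReal.ofReal r ^ n ≤ K * riemannianVolume n (Metric.eball x (ENNReal.ofReal r))

theorem RegularNear.mono {n : ℕ} {s t : Set M} {K K' : ℝ≥0∞} {δ δ' : ℝ}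
    (h : RegularNear n s K δ) (hst : t ⊆ s) (hK : K ≤ K') (hδ : δ' ≤ δ) :
    RegularNear n t K' δ' := by
  intro x hx r hr hrδ
  obtain ⟨h1, h2⟩ := h x
    (Metric.thickening_mono hδ s (Metric.thickening_subset_of_subset δ' hst hx)) r hr (hrδ.trans hδ)
  exact ⟨h1.trans (by gcongr), h2.trans (by gcongr)⟩

end Regular

section RegularRiemannian

variable {n : ℕ} {M : Type*} [EMetricSpace M] [ChartedSpace (EuclideanSpace ℝ (Fin n)) M]
  [IsManifold (𝓡 n) 1 M] [RiemannianBundle (fun x : M => TangentSpace (𝓡 n) x)]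
  [IsContinuousRiemannianBundle (EuclideanSpace ℝ (Fin n)) (fun x : M => TangentSpace (𝓡 n) x)]
  [IsRiemannianManifold (𝓡 n) M] [MeasurableSpace M] [BorelSpace M]

variable (n) in
theorem exists_regularNear {Λ : Set M} (hΛ : IsCompact Λ) :
    ∃ (K : ℝ≥0∞) (δ : ℝ), K ≠ ⊤ ∧ 0 < δ ∧ RegularNear n Λ K δ := by
  refine hΛ.induction_on ⟨0, 1, by simp, one_pos, by simp [RegularNear]⟩ ?_ ?_ ?_
  · rintro s t hst ⟨K, δ, hK, hδ, h⟩
    exact ⟨K, δ, hK, hδ, h.mono hst le_rfl le_rfl⟩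
  · rintro s t ⟨K, δ, hK, hδ, h⟩ ⟨K', δ', hK', hδ', h'⟩
    refine ⟨max K K', min δ δ', by simp [hK, hK'], lt_min hδ hδ', ?_⟩
    intro x hx
    rw [Metric.thickening_union] at hx
    rcases hx with hx | hx
    · exact h.mono le_rfl (le_max_left K K') (min_le_left δ δ') x hx
    · exact h'.mono le_rfl (le_max_right K K') (min_le_right δ δ') x hx
  · intro x _
    obtain ⟨K, δ, hK, hδ, h⟩ := exists_riemannianVolume_eball n x
    -- Half the radius, so that the `δ / 2`-neighborhood of this ball still lies in `B(x, δ)`.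
    refine ⟨Metric.eball x (ENNReal.ofReal (δ / 2)),
      mem_nhdsWithin_of_mem_nhds (Metric.eball_mem_nhds x (by simpa using hδ)),
      K, δ / 2, hK, by positivity, fun y hy r hr hrδ => h y ?_ r hr (by linarith)⟩
    obtain ⟨z, hz, hyz⟩ := (Metric.mem_thickening_iff_exists_edist_lt _ _).1 hy
    rw [← add_halves δ, ENNReal.ofReal_add (by positivity) (by positivity)]
    exact (edist_triangle y z x).trans_lt (ENNReal.add_lt_add hyz hz)

variable (n M) in
theorem isLocallyFiniteMeasure_riemannianVolume :
    IsLocallyFiniteMeasure (riemannianVolume n : Measure M) := by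
  refine ⟨fun x => ?_⟩
  obtain ⟨K, δ, hK, hδ, h⟩ := exists_riemannianVolume_eball n x
  have hδ' : 0 < ENNReal.ofReal δ := ENNReal.ofReal_pos.2 hδ
  refine ⟨_, Metric.eball_mem_nhds x hδ', ?_⟩
  refine lt_of_le_of_lt (h x (Metric.mem_eball_self hδ') δ hδ le_rfl).1 ?_
  finiteness

end RegularRiemannian

/-! ### Complementary components and finiteness near `Λ`. -/

section Components

variable {M : Type*} [EMetricSpace M] {Λ : Set M}

theorem complComponents_isPreconnected (D : complComponents Λ) : IsPreconnected (D : Set M) := by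
  obtain ⟨_, x, -, rfl⟩ := D
  exact isPreconnected_connectedComponentIn

theorem complComponents_subset (D : complComponents Λ) : (D : Set M) ⊆ Λᶜ := by
  obtain ⟨_, x, -, rfl⟩ := D
  exact connectedComponentIn_subset _ _

theorem subset_complComponent {s : Set M} (hs : IsPreconnected s) (hsΛ : s ⊆ Λᶜ)
    {D : complComponents Λ} (h : (s ∩ (D : Set M)).Nonempty) : s ⊆ D := by
  obtain ⟨y, hys, hyD⟩ := h
  obtain ⟨x, -, hx⟩ := D.2
  rw [← hx] at hyD ⊢
  rw [connectedComponentIn_eq hyD]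
  exact hs.subset_connectedComponentIn hys hsΛ

theorem complComponents_eq {D D' : complComponents Λ} (h : ((D : Set M) ∩ D').Nonempty) :
    D = D' :=
  Subtype.ext <| Subset.antisymm
    (subset_complComponent (complComponents_isPreconnected D) (complComponents_subset D) h)
    (subset_complComponent (complComponents_isPreconnected D') (complComponents_subset D')
      (by rwa [inter_comm]))

theorem complComponents_disjoint {D D' : complComponents Λ} (h : D ≠ D') :
    Disjoint (D : Set M) D' :=
  disjoint_iff_inter_eq_empty.2 (not_nonempty_iff_eq_empty.1 fun h' => h (complComponents_eq h'))

theorem exists_mem_complComponents {x : M} (hx : x ∉ Λ) :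
    ∃ D : complComponents Λ, x ∈ (D : Set M) :=
  ⟨⟨_, x, hx, rfl⟩, mem_connectedComponentIn hx⟩

theorem isOpen_complComponents [LocallyConnectedSpace M] (hΛ : IsClosed Λ) (D : complComponents Λ) :
    IsOpen (D : Set M) := by
  obtain ⟨_, x, -, rfl⟩ := D
  exact hΛ.isOpen_compl.connectedComponentIn

theorem countable_complComponents [LocallyConnectedSpace M] [SecondCountableTopology M]
    (hΛ : IsClosed Λ) : Countable (complComponents Λ) := by
  refine Set.Countable.to_subtype ?_
  refine PairwiseDisjoint.countable_of_isOpen (s := id) ?_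
    (fun D hD => isOpen_complComponents hΛ ⟨D, hD⟩) ?_
  · intro D hD D' hD' h
    exact complComponents_disjoint (D := ⟨D, hD⟩) (D' := ⟨D', hD'⟩) (by simpa using h)
  · rintro _ ⟨x, hx, rfl⟩
    exact ⟨x, mem_connectedComponentIn hx⟩

/-- A connected set that meets two complementary components meets `Λ`. -/
theorem _root_.IsPreconnected.inter_nonempty_of_ne {s : Set M} (hs : IsPreconnected s)
    {D D' : complComponents Λ} (hD : (s ∩ (D : Set M)).Nonempty) (hD' : (s ∩ (D' : Set M)).Nonempty)
    (h : D ≠ D') : (s ∩ Λ).Nonempty := by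
  by_contra hsΛ
  have hsΛ' : s ⊆ Λᶜ := fun x hx hxΛ => hsΛ ⟨x, hx, hxΛ⟩
  obtain ⟨x, hx, hxD'⟩ := hD'
  exact h (complComponents_eq ⟨x, subset_complComponent hs hsΛ' hD hx, hxD'⟩)

/-- A component that meets a connected set intersecting `Λ` accumulates at `Λ`. -/
theorem inter_thickening_nonempty [LocallyConnectedSpace M] (hΛ : IsClosed Λ) {s : Set M}
    (hs : IsPreconnected s) {D : complComponents Λ} (hD : (s ∩ (D : Set M)).Nonempty)
    (hsΛ : (s ∩ Λ).Nonempty) {ε : ℝ} (hε : 0 < ε) :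
    ((D : Set M) ∩ Metric.thickening ε Λ).Nonempty := by
  by_contra hempty
  have hdisj : Disjoint (Metric.thickening ε Λ) (D : Set M) := by
    rw [disjoint_comm, disjoint_iff_inter_eq_empty]
    exact not_nonempty_iff_eq_empty.1 hempty
  -- A component at positive distance from `Λ` has no limit points in `Λ` or in other components. It
  -- is therefore open and closed, and a connected set meeting it would be contained in it.
  have hclosed : IsClosed (D : Set M) := by
    refine isClosed_of_closure_subset fun x hx => ?_
    have hxΛ : x ∉ Λ := fun hxΛ =>
      (hdisj.closure_right Metric.isOpen_thickening).le_bot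
        ⟨Metric.self_subset_thickening hε Λ hxΛ, hx⟩
    obtain ⟨D', hxD'⟩ := exists_mem_complComponents hxΛ
    obtain ⟨y, hyD', hyD⟩ := mem_closure_iff.1 hx _ (isOpen_complComponents hΛ D') hxD'
    rwa [complComponents_eq ⟨y, hyD, hyD'⟩]
  have := hs.subset_isClopen ⟨hclosed, isOpen_complComponents hΛ D⟩ hD
  obtain ⟨x, hxs, hxΛ⟩ := hsΛ
  exact complComponents_subset D (this hxs) hxΛ

/-- Such a component is connected, so it meets the set at distance exactly `δ / 2` from `Λ`. That
set is compact and is covered by the disjoint open components, hence by finitely many of them. -/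
theorem finite_components_leaving [LocallyConnectedSpace M] (hΛ : IsClosed Λ) {δ : ℝ} (hδ : 0 < δ)
    (hc : IsCompact (Metric.cthickening δ Λ)) :
    {D : complComponents Λ | ((D : Set M) ∩ Metric.thickening (δ / 2) Λ).Nonempty ∧
      ¬ (D : Set M) ⊆ Metric.thickening δ Λ}.Finite := by
  set F : Set M := {x | Metric.infEDist x Λ = ENNReal.ofReal (δ / 2)} with hF
  have hFc : IsCompact F := by
    refine hc.of_isClosed_subset (isClosed_eq Metric.continuous_infEDist continuous_const) ?_
    intro x hx
    rw [Metric.mem_cthickening_iff, show Metric.infEDist x Λ = _ from hx]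
    exact ENNReal.ofReal_le_ofReal (by linarith)
  have hFΛ : F ⊆ ⋃ D : complComponents Λ, (D : Set M) := by
    intro x hx
    have hxΛ : x ∉ Λ := by
      intro hxΛ
      have h0 : Metric.infEDist x Λ = ENNReal.ofReal (δ / 2) := hx
      rw [Metric.infEDist_zero_of_mem hxΛ] at h0
      exact absurd h0.symm (ENNReal.ofReal_pos.2 (by positivity)).ne'
    exact mem_iUnion.2 (exists_mem_complComponents hxΛ)
  obtain ⟨t, ht⟩ := hFc.elim_finite_subcover _ (isOpen_complComponents hΛ) hFΛ
  refine t.finite_toSet.subset ?_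
  rintro D ⟨⟨x, hxD, hx⟩, hD⟩
  obtain ⟨y, hyD, hy⟩ := not_subset.1 hD
  have hy' : ENNReal.ofReal (δ / 2) ≤ Metric.infEDist y Λ :=
    (ENNReal.ofReal_le_ofReal (by linarith)).trans (not_lt.1 hy)
  obtain ⟨z, hzD, hz⟩ := (complComponents_isPreconnected D).intermediate_value hxD hyD
    Metric.continuous_infEDist.continuousOn ⟨le_of_lt hx, hy'⟩
  obtain ⟨D', hD', hzD'⟩ := mem_iUnion₂.1 (ht (show z ∈ F from hz))
  rw [complComponents_eq ⟨z, hzD, hzD'⟩]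
  exact hD'

variable [MeasurableSpace M] [BorelSpace M]

/-- The components contain disjoint balls of radius `min η δ`, each of volume bounded below, all
within a set of finite volume. -/
theorem finite_components_large {n : ℕ} {K : ℝ≥0∞} {δ : ℝ} (hK : K ≠ ⊤) (hδ : 0 < δ)
    (hreg : RegularNear n Λ K δ)
    (hfin : riemannianVolume n (Metric.thickening (δ + δ) Λ) ≠ ⊤)
    {p : complComponents Λ → M} {r : complComponents Λ → ℝ}
    (hr : ∀ D, Metric.eball (p D) (ENNReal.ofReal (r D)) ⊆ D) {η : ℝ} (hη : 0 < η) :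
    {D : complComponents Λ | p D ∈ Metric.thickening δ Λ ∧ η ≤ r D}.Finite := by
  set S := {D : complComponents Λ | p D ∈ Metric.thickening δ Λ ∧ η ≤ r D}
  have hs : 0 < min η δ := lt_min hη hδ
  set As : S → Set M := fun D => Metric.eball (p D) (ENNReal.ofReal (min η δ))
  have hAs : ∀ D : S, As D ⊆ (D : complComponents Λ) := fun D =>
    (Metric.eball_subset_eball (ENNReal.ofReal_le_ofReal ((min_le_left _ _).trans D.2.2))).trans
      (hr D)
  have hpos : 0 < ENNReal.ofReal (min η δ) ^ n / K :=
    ENNReal.div_pos (pow_ne_zero _ (ENNReal.ofReal_pos.2 hs).ne') hK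
  have hfinite := Measure.finite_const_le_meas_of_disjoint_iUnion (riemannianVolume n) hpos
    (As := As) (fun _ => Metric.isOpen_eball.measurableSet) ?_ ?_
  · have huniv : {D : S | ENNReal.ofReal (min η δ) ^ n / K ≤ riemannianVolume n (As D)} = univ := by
      refine eq_univ_of_forall fun D => ENNReal.div_le_of_le_mul ?_
      rw [mul_comm]
      exact (hreg _ D.2.1 _ hs (min_le_right _ _)).2
    rw [huniv] at hfinite
    have := finite_univ_iff.1 hfinite
    exact S.toFinite
  · intro D D' h
    exact (complComponents_disjoint (Subtype.coe_ne_coe.2 h)).mono (hAs D) (hAs D')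
  · refine ne_top_of_le_ne_top hfin (measure_mono (iUnion_subset fun D x hx => ?_))
    obtain ⟨z, hz, hpz⟩ := (Metric.mem_thickening_iff_exists_edist_lt _ _).1 D.2.1
    refine (Metric.mem_thickening_iff_exists_edist_lt _ _).2 ⟨z, hz, ?_⟩
    rw [ENNReal.ofReal_add hδ.le hδ.le]
    exact (edist_triangle x (p D) z).trans_lt (ENNReal.add_lt_add
      (lt_of_lt_of_le hx (ENNReal.ofReal_le_ofReal (min_le_right _ _))) hpz)

end Components

/-! ### Finiteness of the discrete sum along almost every curve. -/

section DiscretePart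

variable {M : Type*} [EMetricSpace M] {Λ : Set M} [MeasurableSpace M] [BorelSpace M]

/-- The balls attached to the small complementary components near `Λ` satisfy the assumptions of
Bojarski's lemma. -/
theorem ballFamily_complComponents {n : ℕ} {K : ℝ≥0∞} {δ C : ℝ} (hK : K ≠ ⊤) (hC : 1 ≤ C)
    (hreg : RegularNear n Λ K δ) {J : Set (complComponents Λ)} {p : complComponents Λ → M}
    {r R : complComponents Λ → ℝ} (hr : ∀ D, 0 < r D) (hrR : ∀ D, r D ≤ R D)
    (hsub : ∀ D, Metric.eball (p D) (ENNReal.ofReal (r D)) ⊆ D) (hCR : ∀ D, R D ≤ C * r D)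
    (hp : ∀ D ∈ J, p D ∈ Metric.thickening δ Λ) (hR : ∀ D ∈ J, 10 * R D ≤ δ) :
    BallFamily (riemannianVolume n) (max 1 (K ^ 2 * ENNReal.ofReal (10 * C) ^ n))
      (fun D : J => Metric.eball (p D) (ENNReal.ofReal (r D)))
      (fun D : J => Metric.eball (p D) (ENNReal.ofReal (2 * R D)))
      (fun D : J => Metric.eball (p D) (ENNReal.ofReal (10 * R D))) (fun D : J => R D) where
  one_le := le_max_left _ _
  ne_top := (max_lt ENNReal.one_lt_top (by finiteness)).ne
  measurableSet_inner D := Metric.isOpen_eball.measurableSet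
  measurableSet_outer D := Metric.isOpen_eball.measurableSet
  disjoint D D' h :=
    (complComponents_disjoint (Subtype.coe_ne_coe.2 h)).mono (hsub D) (hsub D')
  measure_ne_zero D h := by
    have h1 := (hreg _ (hp D D.2) _ (hr D)
      (by linarith [hrR D, hR D D.2, (hr D).trans_le (hrR D)])).2
    rw [h, mul_zero, nonpos_iff_eq_zero] at h1
    exact (ENNReal.ofReal_pos.2 (hr D)).ne' (eq_zero_of_pow_eq_zero h1)
  measure_ne_top D := by
    have h1 := (hreg _ (hp D D.2) _ (hr D)
      (by linarith [hrR D, hR D D.2, (hr D).trans_le (hrR D)])).1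
    exact ne_top_of_le_ne_top (by finiteness) h1
  radius_nonneg D := ((hr D).trans_le (hrR D)).le
  outer_nonempty D := ⟨p D, Metric.mem_eball_self
    (ENNReal.ofReal_pos.2 (by linarith [hr D, hrR D]))⟩
  outer_subset D := Metric.eball_subset_eball
    (ENNReal.ofReal_le_ofReal (by linarith [hr D, hrR D]))
  measure_le D := by
    have h0 : 0 < R D := (hr D).trans_le (hrR D)
    have h1 := (hreg _ (hp D D.2) (10 * R D) (by positivity) (hR D D.2)).1
    have h2 := (hreg _ (hp D D.2) _ (hr D) (by linarith [hrR D, hR D D.2])).2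
    calc riemannianVolume n (Metric.eball (p D) (ENNReal.ofReal (10 * R D)))
        ≤ K * ENNReal.ofReal (10 * R D) ^ n := h1
      _ ≤ K * ENNReal.ofReal (10 * C * r D) ^ n := by
          refine mul_le_mul' le_rfl (pow_le_pow_left' (ENNReal.ofReal_le_ofReal ?_) n)
          linarith [hCR D]
      _ = K * ENNReal.ofReal (10 * C) ^ n * ENNReal.ofReal (r D) ^ n := by
          rw [ENNReal.ofReal_mul (by positivity)]
          ring
      _ ≤ K * ENNReal.ofReal (10 * C) ^ n *
          (K * riemannianVolume n (Metric.eball (p D) (ENNReal.ofReal (r D)))) := by gcongr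
      _ = K ^ 2 * ENNReal.ofReal (10 * C) ^ n *
          riemannianVolume n (Metric.eball (p D) (ENNReal.ofReal (r D))) := by ring
      _ ≤ _ := by
          gcongr
          exact le_max_right _ _
  inner_subset D D' h hle := by
    obtain ⟨x, hx, hx'⟩ := h
    intro y hy
    have h0 : 0 < R D := (hr D).trans_le (hrR D)
    have h0' : 0 < R D' := (hr D').trans_le (hrR D')
    rw [Metric.mem_eball] at *
    rw [edist_comm] at hx
    calc edist y (p D') ≤ edist y (p D) + edist (p D) x + edist x (p D') :=
          (edist_triangle _ x _).trans (add_le_add_left (edist_triangle _ _ _) _)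
      _ < ENNReal.ofReal (r D) + ENNReal.ofReal (2 * R D) + ENNReal.ofReal (2 * R D') :=
          ENNReal.add_lt_add (ENNReal.add_lt_add hy hx) hx'
      -- With `r ≤ R ≤ 2R'` the sum `r + 2R + 2R'` is at most `8R'`.
      _ ≤ ENNReal.ofReal (10 * R D') := by
          rw [← ENNReal.ofReal_add (hr D).le (by positivity),
            ← ENNReal.ofReal_add (by linarith [hr D]) (by positivity)]
          exact ENNReal.ofReal_le_ofReal (by linarith [hrR D])

/-- The components met by a curve have, outside a finite set, small radius compared with the
diameter of the curve and center close to `Λ`, provided the curve meets at least two of them. -/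
theorem finite_hit_not_mem [LocallyConnectedSpace M] (hΛ : IsClosed Λ) {n : ℕ} {K : ℝ≥0∞} {δ C : ℝ}
    (hK : K ≠ ⊤) (hδ : 0 < δ) (hC : 1 ≤ C) (hreg : RegularNear n Λ K δ)
    (hc : IsCompact (Metric.cthickening δ Λ))
    (hfin : riemannianVolume n (Metric.thickening (δ + δ) Λ) ≠ ⊤) {p : complComponents Λ → M}
    {r R : complComponents Λ → ℝ} (hpD : ∀ D : complComponents Λ, p D ∈ (D : Set M))
    (hsub : ∀ D, Metric.eball (p D) (ENNReal.ofReal (r D)) ⊆ D) (hCR : ∀ D, R D ≤ C * r D)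
    {s : Set M} (hs : IsPreconnected s) {η : ℝ} (hη : 0 < η) (hsΛ : (s ∩ Λ).Nonempty) :
    {D : complComponents Λ | (s ∩ (D : Set M)).Nonempty ∧
      ¬ (p D ∈ Metric.thickening δ Λ ∧ R D < η)}.Finite := by
  refine ((finite_components_leaving hΛ hδ hc).union
    (finite_components_large hK hδ hreg hfin hsub (η := η / C) (by positivity))).subset ?_
  rintro D ⟨hD, hnot⟩
  by_cases hpt : p D ∈ Metric.thickening δ Λ
  · refine Or.inr ⟨hpt, ?_⟩
    rw [div_le_iff₀ (by positivity), mul_comm]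
    exact (not_lt.1 fun h => hnot ⟨hpt, h⟩).trans (hCR D)
  · exact Or.inl ⟨inter_thickening_nonempty hΛ hs hD hsΛ (by positivity), fun h => hpt (h (hpD D))⟩

/-- If `∑ a(D)ⁿ < ∞`, then `∑ a(D)` over the components `D` met by a curve is finite for all
rectifiable curves along which a certain density in `Lⁿ` is integrable. -/
theorem BoundedGeometry.exists_density [LocallyConnectedSpace M] [LocallyCompactSpace M]
    [SecondCountableTopology M] (hΛ : IsCompact Λ) {n : ℕ} (hn : 2 ≤ n)
    [IsLocallyFiniteMeasure (riemannianVolume n : Measure M)]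
    (hreg : ∃ (K : ℝ≥0∞) (δ : ℝ), K ≠ ⊤ ∧ 0 < δ ∧ RegularNear n Λ K δ)
    (hD : BoundedGeometry fun D : complComponents Λ => (D : Set M))
    {a : complComponents Λ → ℝ≥0∞} (ha : ∑' D, a D ^ n ≠ ⊤) :
    ∃ g : M → ℝ≥0∞, Measurable g ∧ ∫⁻ x, g x ^ n ∂(riemannianVolume n) ≠ ⊤ ∧
      ∀ γ : Curve M, Rectifiable γ → lineIntegral g γ ≠ ⊤ →
        ∑' D : {D : complComponents Λ // (range γ ∩ (D : Set M)).Nonempty}, a D ≠ ⊤ := by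
  obtain ⟨m, rfl⟩ : ∃ m, n = m + 1 := ⟨n - 1, by omega⟩
  have hm : m ≠ 0 := by omega
  obtain ⟨K, δ₀, hK, hδ₀, hreg₀⟩ := hreg
  obtain ⟨δ₁, hδ₁, hc₁⟩ := hΛ.exists_isCompact_cthickening
  have hδ : 0 < min δ₀ (δ₁ / 2) := lt_min hδ₀ (by positivity)
  have hreg := hreg₀.mono Subset.rfl le_rfl (min_le_left δ₀ (δ₁ / 2))
  have hle : min δ₀ (δ₁ / 2) + min δ₀ (δ₁ / 2) ≤ δ₁ := by linarith [min_le_right δ₀ (δ₁ / 2)]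
  generalize min δ₀ (δ₁ / 2) = δ at hδ hreg hle
  have hc : IsCompact (Metric.cthickening δ Λ) :=
    hc₁.of_isClosed_subset Metric.isClosed_cthickening (Metric.cthickening_mono (by linarith) _)
  have hfin : riemannianVolume (m + 1) (Metric.thickening (δ + δ) Λ) ≠ ⊤ :=
    ((measure_mono ((Metric.thickening_subset_cthickening _ _).trans
      (Metric.cthickening_mono hle _))).trans_lt hc₁.measure_lt_top).ne
  obtain ⟨C, hC, p, r, R, hgeo⟩ := hD
  have hpD := fun D => (hgeo D).1
  have hr := fun D => (hgeo D).2.1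
  have hrR := fun D => (hgeo D).2.2.1
  have hsub := fun D => (hgeo D).2.2.2.1
  have hDsub := fun D => (hgeo D).2.2.2.2.1
  have hCR : ∀ D, R D ≤ C * r D := fun D => (div_le_iff₀ (hr D)).1 (hgeo D).2.2.2.2.2
  have hR0 : ∀ D, 0 < R D := fun D => (hr D).trans_le (hrR D)
  have hcount := countable_complComponents hΛ.isClosed
  have hat : ∀ D, a D ≠ ⊤ := fun D h => ENNReal.ne_top_of_tsum_ne_top ha D (by simp [h])
  -- The bound `δ / 10` keeps the balls of radius `10 R`, used as enlargements in `BallFamily`,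
  -- within the scale of volume regularity.
  set J : Set (complComponents Λ) := {D | p D ∈ Metric.thickening δ Λ ∧ R D < δ / 10} with hJ
  have H := ballFamily_complComponents hK hC hreg hr hrR hsub hCR (J := J) (fun D h => h.1)
    (fun D h => by linarith [h.2])
  set c : J → ℝ≥0∞ := fun D => a D / ENNReal.ofReal (R D) with hcdef
  have hcR : ∀ D : J, c D * ENNReal.ofReal (R D) = a D := fun D =>
    ENNReal.div_mul_cancel (ENNReal.ofReal_pos.2 (hR0 D)).ne' ENNReal.ofReal_ne_top
  have hct : ∀ D, c D ≠ ⊤ := fun D =>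
    ENNReal.div_ne_top (hat D) (ENNReal.ofReal_pos.2 (hR0 D)).ne'
  have hmeas : ∀ D : J, Measurable fun x => c D *
      (Metric.eball (p D) (ENNReal.ofReal (2 * R D))).indicator (1 : M → ℝ≥0∞) x := fun D =>
    (measurable_one.indicator (H.measurableSet_outer D)).const_mul _
  refine ⟨fun x => ∑' D : J, c D *
    (Metric.eball (p D) (ENNReal.ofReal (2 * R D))).indicator 1 x, Measurable.tsum hmeas,
    ?_, ?_⟩
  · refine ne_top_of_le_ne_top ?_ (H.lintegral_tsum_pow_le hm hct)
    -- The volume of the inner ball is at most `K * R ^ n`, which cancels the factor `R⁻ⁿ` in `c ^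
    -- n`.
    have h1 : ∑' D : J, c D ^ (m + 1) *
        riemannianVolume (m + 1) (Metric.eball (p D) (ENNReal.ofReal (r D))) ≤
        K * ∑' D, a D ^ (m + 1) := by
      calc _ ≤ ∑' D : J, K * a D ^ (m + 1) := by
            refine ENNReal.tsum_le_tsum fun D => ?_
            have h2 := (hreg _ D.2.1 _ (hr D) (by linarith [hrR D, D.2.2, hR0 D])).1
            calc _ ≤ c D ^ (m + 1) * (K * ENNReal.ofReal (R D) ^ (m + 1)) := by
                  gcongr
                  exact h2.trans (by gcongr; exact hrR D)
              _ = K * (c D * ENNReal.ofReal (R D)) ^ (m + 1) := by ring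
              _ = K * a D ^ (m + 1) := by rw [hcR]
        _ = K * ∑' D : J, a D ^ (m + 1) := ENNReal.tsum_mul_left
        _ ≤ _ := by
            gcongr
            exact ENNReal.tsum_comp_le_tsum_of_injective Subtype.val_injective
              (fun D => a D ^ (m + 1))
    have h2 := H.ne_top
    exact ENNReal.mul_ne_top (by finiteness)
      (ne_top_of_le_ne_top (ENNReal.mul_ne_top hK ha) h1)
  · intro γ hγ hgγ
    rw [lineIntegral_tsum hγ hmeas] at hgγ
    set hit : Set (complComponents Λ) := {D | (range γ ∩ (D : Set M)).Nonempty} with hhit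
    set I : J → ℝ≥0∞ := fun D => lineIntegral (fun x => c D *
      (Metric.eball (p D) (ENNReal.ofReal (2 * R D))).indicator (1 : M → ℝ≥0∞) x) γ with hI
    have hs : IsPreconnected (range γ) := isPreconnected_range γ.continuous
    -- A curve meeting at most one component needs no estimate. Otherwise it meets `Λ` and contains
    -- two distinct points `x`, `y`. If `4η ≤ d(x, y)`, it cannot lie in a ball `B(p, 2R)` with `R <
    -- η`, so the length estimate applies to all but finitely many components it meets.
    have hF : {D ∈ hit | ¬ ∃ h : D ∈ J, a D ≤ I ⟨D, h⟩}.Finite := by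
      by_cases hsub' : hit.Subsingleton
      · exact hsub'.finite.subset (sep_subset _ _)
      obtain ⟨D₁, hD₁, D₂, hD₂, hne⟩ := not_subsingleton_iff.1 hsub'
      have hsΛ := hs.inter_nonempty_of_ne hD₁ hD₂ hne
      obtain ⟨x, hx, hxD₁⟩ := id hD₁
      obtain ⟨y, hy, hyD₂⟩ := id hD₂
      have hxy : x ≠ y := fun h => hne (complComponents_eq ⟨x, hxD₁, h ▸ hyD₂⟩)
      obtain ⟨η, hη, hηd⟩ : ∃ η : ℝ, 0 < η ∧ ENNReal.ofReal (4 * η) ≤ edist x y := by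
        obtain ⟨q, hq, hqd⟩ := ENNReal.lt_iff_exists_nnreal_btwn.1 (edist_pos.2 hxy)
        refine ⟨q / 4, by have : (0 : ℝ) < q := by exact_mod_cast hq
                          positivity, ?_⟩
        rw [mul_div_cancel₀ _ (by norm_num), ENNReal.ofReal_coe_nnreal]
        exact hqd.le
      refine (finite_hit_not_mem hΛ.isClosed hK hδ hC hreg hc hfin hpD hsub hCR hs
        (η := min (δ / 10) η) (lt_min (by positivity) hη) hsΛ).subset ?_
      rintro D ⟨hDhit, hDnot⟩
      refine ⟨hDhit, fun ⟨hpt, hRη⟩ => hDnot ?_⟩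
      have hDJ : D ∈ J := ⟨hpt, hRη.trans_le (min_le_left _ _)⟩
      refine ⟨hDJ, ?_⟩
      obtain ⟨_, ⟨t, rfl⟩, htD⟩ := hDhit
      obtain ⟨u, hu⟩ : ∃ u, γ u ∉ Metric.eball (p D) (ENNReal.ofReal (2 * R D)) := by
        by_contra! hall
        obtain ⟨t₁, rfl⟩ := hx
        obtain ⟨t₂, rfl⟩ := hy
        refine hηd.not_gt ((edist_triangle_right _ _ (p D)).trans_lt
          ((ENNReal.add_lt_add (hall t₁) (hall t₂)).trans_le ?_))
        have := hR0 D
        rw [← ENNReal.ofReal_add (by positivity) (by positivity)]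
        exact ENNReal.ofReal_le_ofReal (by linarith [min_le_right (δ / 10) η])
      have hle := hγ.le_lineIntegral_indicator_eball (hDsub D htD) hu
      rw [hI]
      dsimp only
      rw [lineIntegral_const_mul (hct ⟨D, hDJ⟩), ← hcR ⟨D, hDJ⟩]
      exact mul_le_mul' le_rfl hle
    set F := {D ∈ hit | ¬ ∃ h : D ∈ J, a D ≤ I ⟨D, h⟩} with hFdef
    have hbound : ∀ D : hit, a D ≤ F.indicator a D + Function.extend Subtype.val I 0 D.1 := by
      intro D
      by_cases h : ∃ h : D.1 ∈ J, a D ≤ I ⟨D, h⟩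
      · obtain ⟨hJD, hle⟩ := h
        refine hle.trans (le_add_left (le_of_eq ?_))
        exact (Subtype.val_injective.extend_apply I 0 (⟨D.1, hJD⟩ : J)).symm
      · rw [indicator_of_mem (show D.1 ∈ F from ⟨D.2, h⟩)]
        exact le_self_add
    refine ne_top_of_le_ne_top ?_ (ENNReal.tsum_le_tsum hbound)
    refine ne_top_of_le_ne_top ?_ (ENNReal.tsum_comp_le_tsum_of_injective Subtype.val_injective
      fun D => F.indicator a D + Function.extend Subtype.val I 0 D)
    rw [ENNReal.tsum_add, tsum_extend_zero Subtype.val_injective, ← tsum_subtype]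
    refine ENNReal.add_ne_top.2 ⟨?_, hgγ⟩
    have := hF.fintype
    rw [tsum_fintype]
    exact ENNReal.sum_ne_top.2 fun D _ => hat D

end DiscretePart

/-! ### Clarkson's inequality. -/

section Clarkson

/-- The two bounds carry each other through the induction: with `S` and `T` the sum and the
difference of the two `n`-th powers, the next ones are `u * S + v * T` and `u * T + v * S`. -/
theorem add_pow_add_sub_pow {u v : ℝ} (hv : 0 ≤ v) (huv : v ≤ u) {n : ℕ} (hn : 2 ≤ n) :
    2 * (u ^ n + v ^ n) ≤ (u + v) ^ n + (u - v) ^ n ∧ 2 * v ^ n ≤ (u + v) ^ n - (u - v) ^ n := by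
  have hu : 0 ≤ u := hv.trans huv
  induction n, hn using Nat.le_induction with
  | base => constructor <;> nlinarith
  | succ n hn ih =>
    obtain ⟨h1, h2⟩ := ih
    have hun : 0 ≤ u ^ n := by positivity
    have hvn : 0 ≤ v ^ n := by positivity
    have h3 := mul_le_mul_of_nonneg_left h1 hu
    have h4 := mul_le_mul_of_nonneg_left h1 hv
    have h5 := mul_le_mul_of_nonneg_left h2 hv
    have h6 := mul_le_mul_of_nonneg_left h2 hu
    have h7 : 0 ≤ u * v ^ n := by positivity
    have h8 : 0 ≤ v * u ^ n := by positivity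
    constructor <;> ring_nf at * <;> linarith

/-- Clarkson's inequality for two nonnegative numbers and an exponent `n ≥ 2`. -/
theorem clarkson {n : ℕ} (hn : 2 ≤ n) (a b : ℝ≥0) :
    2 * (((a + b) / 2) ^ n + (nndist a b / 2) ^ n) ≤ a ^ n + b ^ n := by
  wlog hab : b ≤ a generalizing a b
  · have := this b a (le_of_not_ge hab)
    rwa [nndist_comm, add_comm b, add_comm (b ^ n)] at this
  have hab' : (b : ℝ) ≤ a := hab
  have h := (add_pow_add_sub_pow (u := ((a : ℝ) + b) / 2) (v := ((a : ℝ) - b) / 2)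
    (by linarith) (by linarith [b.coe_nonneg]) hn).1
  rw [← NNReal.coe_le_coe]
  push_cast
  rw [NNReal.dist_eq, abs_of_nonneg (by linarith)]
  convert h using 2 <;> ring

end Clarkson

/-! ### Limits inferior and geometric convergence. -/

section Limits

open Filter Topology

theorem liminf_add_liminf_le (u v : ℕ → ℝ≥0∞) :
    liminf u atTop + liminf v atTop ≤ liminf (fun k => u k + v k) atTop := by
  simp only [liminf_eq_iSup_iInf_of_nat]
  have hmono : ∀ w : ℕ → ℝ≥0∞, Monotone fun k => ⨅ i ≥ k, w i := fun w k l hkl =>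
    le_iInf₂ fun i hi => iInf₂_le i (hkl.trans hi)
  rw [ENNReal.iSup_add_iSup_of_monotone (hmono u) (hmono v)]
  exact iSup_mono fun k => le_iInf₂ fun i hi => add_le_add (iInf₂_le i hi) (iInf₂_le i hi)

theorem liminf_pow (u : ℕ → ℝ≥0∞) (n : ℕ) :
    liminf u atTop ^ n = liminf (fun k => u k ^ n) atTop :=
  Monotone.map_liminf_of_continuousAt (f := fun x : ℝ≥0∞ => x ^ n)
    (fun _ _ h => pow_le_pow_left' h n) u (ENNReal.continuous_pow n).continuousAt

/-- Fatou's lemma for the counting measure; the σ-algebra `⊤` makes every function measurable. -/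
theorem tsum_liminf_le {ι : Type*} (f : ℕ → ι → ℝ≥0∞) :
    ∑' i, liminf (fun k => f k i) atTop ≤ liminf (fun k => ∑' i, f k i) atTop := by
  let _ : MeasurableSpace ι := ⊤
  have h := lintegral_liminf_le (μ := Measure.count) (f := f) (u := atTop)
    fun k => measurable_from_top
  simpa only [lintegral_count] using h

/-- A sequence whose steps are dominated by `2⁻ᵏ W` stays below its limit inferior, up to an error
of order `2⁻ᵏ W`. -/
theorem coe_le_liminf_add (f : ℕ → ℝ≥0) (k : ℕ) :
    (f k : ℝ≥0∞) ≤ (liminf (fun k => (f k : ℝ≥0∞)) atTop).toNNReal +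
      4 / 2 ^ k * ⨆ j : ℕ, 2 ^ j * ((nndist (f j) (f (j + 1)) / 2 : ℝ≥0) : ℝ≥0∞) := by
  set W := ⨆ j : ℕ, 2 ^ j * ((nndist (f j) (f (j + 1)) / 2 : ℝ≥0) : ℝ≥0∞) with hW
  -- Where `W` is infinite the error term is infinite and nothing is claimed; there the limit
  -- inferior may be infinite and `toNNReal` may turn it into `0`.
  by_cases hWt : W = ⊤
  · rw [hWt, ENNReal.mul_top, add_top]
    · exact le_top
    · exact ENNReal.div_ne_zero.2 ⟨by norm_num, by finiteness⟩
  have hstep : ∀ j, edist (f j) (f (j + 1)) ≤ 2 * W / 2 ^ j := by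
    intro j
    have hj : (2 : ℝ≥0∞) ^ j * ((nndist (f j) (f (j + 1)) / 2 : ℝ≥0) : ℝ≥0∞) ≤ W :=
      le_iSup (fun j : ℕ => 2 ^ j * ((nndist (f j) (f (j + 1)) / 2 : ℝ≥0) : ℝ≥0∞)) j
    rw [ENNReal.le_div_iff_mul_le (Or.inl (by positivity)) (Or.inl (by finiteness))]
    calc edist (f j) (f (j + 1)) * 2 ^ j
        = 2 * (2 ^ j * ((nndist (f j) (f (j + 1)) / 2 : ℝ≥0) : ℝ≥0∞)) := by
          have h2 : (2 : ℝ≥0∞) * ((nndist (f j) (f (j + 1)) / 2 : ℝ≥0) : ℝ≥0∞) =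
              edist (f j) (f (j + 1)) := by
            rw [edist_nndist, ← ENNReal.coe_ofNat, ← ENNReal.coe_mul,
              mul_div_cancel₀ _ two_ne_zero]
          rw [← h2]
          ring
      _ ≤ 2 * W := by gcongr
  have h2W : 2 * W ≠ ⊤ := by finiteness
  -- Steps of size `2W / 2 ^ j` sum from `k` on to `4W / 2 ^ k`, whence the constant `4`.
  obtain ⟨a, ha⟩ := cauchySeq_tendsto_of_complete (cauchySeq_of_edist_le_geometric_two _ h2W hstep)
  have hle := edist_le_of_edist_le_geometric_two_of_tendsto _ hstep ha k
  rw [(ENNReal.tendsto_coe.2 ha).liminf_eq, ENNReal.toNNReal_coe]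
  calc (f k : ℝ≥0∞) ≤ a + edist (f k) a := by
        rw [edist_nndist, ← ENNReal.coe_add, ENNReal.coe_le_coe, ← NNReal.coe_le_coe]
        push_cast
        rw [NNReal.dist_eq]
        linarith [le_abs_self ((f k : ℝ) - a)]
    _ ≤ a + 4 / 2 ^ k * W := by
        gcongr
        refine hle.trans (le_of_eq ?_)
        rw [← mul_assoc, div_eq_mul_inv, div_eq_mul_inv]
        ring

end Limits

/-! ### Mass distributions: convexity, limits, existence and uniqueness. -/

section MassDistribution

variable {M : Type*} [EMetricSpace M] [MeasurableSpace M] {Λ : Set M}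

namespace MassDistribution

/-- The midpoint of two mass distributions. -/
noncomputable def mid (ρ ρ' : MassDistribution Λ) : MassDistribution Λ where
  cont x := (ρ.cont x + ρ'.cont x) / 2
  measurable_cont := (ρ.measurable_cont.add ρ'.measurable_cont).div_const 2
  disc D := (ρ.disc D + ρ'.disc D) / 2

/-- Half the distance of two mass distributions. -/
noncomputable def halfDist (ρ ρ' : MassDistribution Λ) : MassDistribution Λ where
  cont x := nndist (ρ.cont x) (ρ'.cont x) / 2
  measurable_cont := (ρ.measurable_cont.nndist ρ'.measurable_cont).div_const 2
  disc D := nndist (ρ.disc D) (ρ'.disc D) / 2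

/-- The pointwise limit inferior of a sequence of mass distributions (where it is finite). -/
noncomputable def liminf (ρ : ℕ → MassDistribution Λ) : MassDistribution Λ where
  cont x := (Filter.liminf (fun k => ((ρ k).cont x : ℝ≥0∞)) Filter.atTop).toNNReal
  measurable_cont :=
    (Measurable.liminf fun k => (ρ k).measurable_cont.coe_nnreal_ennreal).ennreal_toNNReal
  disc D := (Filter.liminf (fun k => ((ρ k).disc D : ℝ≥0∞)) Filter.atTop).toNNReal

variable [BorelSpace M] {n : ℕ}

theorem mass_mid_add_mass_halfDist (hn : 2 ≤ n) (ρ ρ' : MassDistribution Λ) :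
    2 * ((mid ρ ρ').mass n + (halfDist ρ ρ').mass n) ≤ ρ.mass n + ρ'.mass n := by
  have hcl : ∀ a b : ℝ≥0, (2 : ℝ≥0∞) * ((((a + b) / 2 : ℝ≥0) : ℝ≥0∞) ^ n +
      ((nndist a b / 2 : ℝ≥0) : ℝ≥0∞) ^ n) ≤ (a : ℝ≥0∞) ^ n + (b : ℝ≥0∞) ^ n := fun a b => by
    exact_mod_cast clarkson hn a b
  have hmeas : ∀ ρ : MassDistribution Λ, Measurable fun x => (ρ.cont x : ℝ≥0∞) ^ n := fun ρ =>
    ρ.measurable_cont.coe_nnreal_ennreal.pow_const n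
  have h1 : 2 * (∫⁻ x in Λ, ((mid ρ ρ').cont x : ℝ≥0∞) ^ n ∂(riemannianVolume n) +
      ∫⁻ x in Λ, ((halfDist ρ ρ').cont x : ℝ≥0∞) ^ n ∂(riemannianVolume n)) ≤
      ∫⁻ x in Λ, (ρ.cont x : ℝ≥0∞) ^ n ∂(riemannianVolume n) +
      ∫⁻ x in Λ, (ρ'.cont x : ℝ≥0∞) ^ n ∂(riemannianVolume n) := by
    rw [← lintegral_add_left (hmeas _), ← lintegral_add_left (hmeas _),
      ← lintegral_const_mul' _ _ ENNReal.ofNat_ne_top]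
    exact lintegral_mono fun x => hcl _ _
  have h2 : 2 * (∑' D, ((mid ρ ρ').disc D : ℝ≥0∞) ^ n + ∑' D, ((halfDist ρ ρ').disc D : ℝ≥0∞) ^ n) ≤
      ∑' D, (ρ.disc D : ℝ≥0∞) ^ n + ∑' D, (ρ'.disc D : ℝ≥0∞) ^ n := by
    rw [← ENNReal.tsum_add, ← ENNReal.tsum_add, ← ENNReal.tsum_mul_left]
    exact ENNReal.tsum_le_tsum fun D => hcl _ _
  simp only [mass]
  calc _ = _ := by rw [add_add_add_comm, mul_add]
    _ ≤ _ := add_le_add h1 h2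
    _ = _ := by rw [add_add_add_comm]

/-- Fatou's lemma for both parts. Replacing an infinite limit inferior by `0` only lowers the mass.
-/
theorem mass_liminf_le (ρ : ℕ → MassDistribution Λ) :
    (liminf ρ).mass n ≤ Filter.liminf (fun k => (ρ k).mass n) Filter.atTop := by
  have hcoe : ∀ u : ℕ → ℝ≥0∞, (((Filter.liminf u Filter.atTop).toNNReal : ℝ≥0) : ℝ≥0∞) ^ n ≤
      Filter.liminf (fun k => u k ^ n) Filter.atTop := fun u => by
    rw [← liminf_pow]
    gcongr
    exact ENNReal.coe_toNNReal_le_self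
  refine le_trans (add_le_add ?_ ?_) (liminf_add_liminf_le _ _)
  · exact (lintegral_mono fun x => hcoe _).trans (lintegral_liminf_le fun k =>
      (ρ k).measurable_cont.coe_nnreal_ennreal.pow_const n)
  · exact (ENNReal.tsum_le_tsum fun D => hcoe _).trans (tsum_liminf_le _)

theorem along_mid {γ : Curve M} (hγ : Rectifiable γ) (hΛ : MeasurableSet Λ)
    (ρ ρ' : MassDistribution Λ) : (mid ρ ρ').along γ = 2⁻¹ * (ρ.along γ + ρ'.along γ) := by
  have hcoe : ∀ a b : ℝ≥0, (((a + b) / 2 : ℝ≥0) : ℝ≥0∞) = 2⁻¹ * ((a : ℝ≥0∞) + b) := fun a b => by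
    rw [ENNReal.coe_div two_ne_zero, ENNReal.div_eq_inv_mul, ENNReal.coe_add, ENNReal.coe_ofNat]
  have h1 : (Λ.indicator fun x => ((mid ρ ρ').cont x : ℝ≥0∞)) = fun x =>
      2⁻¹ * (Λ.indicator (fun x => (ρ.cont x : ℝ≥0∞)) x +
        Λ.indicator (fun x => (ρ'.cont x : ℝ≥0∞)) x) := by
    ext x
    by_cases hx : x ∈ Λ
    · simp only [indicator_of_mem hx]
      exact hcoe _ _
    · simp [indicator_of_notMem hx]
  have h2 : ∀ D, ((mid ρ ρ').disc D : ℝ≥0∞) = 2⁻¹ * ((ρ.disc D : ℝ≥0∞) + ρ'.disc D) :=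
    fun D => hcoe _ _
  simp only [along, h1, h2]
  rw [lineIntegral_const_mul (by finiteness),
    lineIntegral_add hγ (ρ.measurable_cont.coe_nnreal_ennreal.indicator hΛ),
    ENNReal.tsum_mul_left, ENNReal.tsum_add, ← mul_add, add_add_add_comm]

/-- The sum along a curve is affine in the distribution on rectifiable curves, so the nonrectifiable
ones join the exceptional family. -/
theorem Admissible.mid (hn : 2 ≤ n) (hΛ : MeasurableSet Λ) {Γ : Set (Curve M)}
    {ρ ρ' : MassDistribution Λ} (h : ρ.Admissible n Γ) (h' : ρ'.Admissible n Γ) :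
    (mid ρ ρ').Admissible n Γ := by
  obtain ⟨Γ₀, hsub, h0, h1⟩ := h
  obtain ⟨Γ₀', hsub', h0', h1'⟩ := h'
  have hn0 : n ≠ 0 := by omega
  refine ⟨Γ ∩ (Γ₀ ∪ Γ₀' ∪ {γ | ¬ Rectifiable γ}), inter_subset_left, ?_, ?_⟩
  · exact le_antisymm ((modulus_mono inter_subset_right).trans (modulus_union_eq_zero
      (modulus_union_eq_zero h0 h0') (modulus_not_rectifiable hn0)).le) (zero_le)
  · rintro γ ⟨hγ, hnot⟩
    simp only [mem_inter_iff, hγ, true_and, mem_union, not_or] at hnot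
    obtain ⟨⟨hγ0, hγ0'⟩, hr⟩ := hnot
    rw [along_mid (not_not.1 hr) hΛ]
    calc (1 : ℝ≥0∞) = 2⁻¹ * (1 + 1) := by
          rw [one_add_one_eq_two, ENNReal.inv_mul_cancel two_ne_zero ENNReal.ofNat_ne_top]
      _ ≤ _ := by
          gcongr
          · exact h1 γ ⟨hγ, hγ0⟩
          · exact h1' γ ⟨hγ, hγ0'⟩

theorem transboundaryModulus_le {Γ : Set (Curve M)} {ρ : MassDistribution Λ}
    (h : ρ.Admissible n Γ) : transboundaryModulus n Λ Γ ≤ ρ.mass n :=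
  iInf₂_le ρ h

/-- Two admissible mass distributions with almost minimal mass are close to each other. -/
theorem Admissible.mass_halfDist_le (hn : 2 ≤ n) (hΛ : MeasurableSet Λ) {Γ : Set (Curve M)}
    (hΓ : transboundaryModulus n Λ Γ ≠ ⊤) {ρ ρ' : MassDistribution Λ} (h : ρ.Admissible n Γ)
    (h' : ρ'.Admissible n Γ) {ε : ℝ≥0∞} (hm : ρ.mass n ≤ transboundaryModulus n Λ Γ + ε)
    (hm' : ρ'.mass n ≤ transboundaryModulus n Λ Γ + ε) : (halfDist ρ ρ').mass n ≤ ε := by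
  have h1 := mass_mid_add_mass_halfDist hn ρ ρ'
  -- The midpoint is admissible, so its mass is at least the modulus; Clarkson's inequality leaves
  -- at most `ε` for the half distance.
  have h2 : transboundaryModulus n Λ Γ + (halfDist ρ ρ').mass n ≤
      transboundaryModulus n Λ Γ + ε := by
    refine (add_le_add_left (transboundaryModulus_le (h.mid hn hΛ h')) _).trans ?_
    refine (ENNReal.mul_le_mul_iff_right two_ne_zero ENNReal.ofNat_ne_top).1 (h1.trans ?_)
    rw [two_mul]
    exact add_le_add hm hm'
  exact (ENNReal.add_le_add_iff_left hΓ).1 h2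

theorem ae_eq_of_mass_halfDist_eq_zero (hn : n ≠ 0) {ρ ρ' : MassDistribution Λ}
    (h : (halfDist ρ ρ').mass n = 0) :
    (∀ᵐ x ∂((riemannianVolume n).restrict Λ), ρ.cont x = ρ'.cont x) ∧ ρ.disc = ρ'.disc := by
  rw [mass, add_eq_zero, lintegral_eq_zero_iff
    ((halfDist ρ ρ').measurable_cont.coe_nnreal_ennreal.pow_const n), ENNReal.tsum_eq_zero] at h
  constructor
  · filter_upwards [h.1] with x hx
    simpa [hn, halfDist] using hx
  · ext1 D
    simpa [hn, halfDist] using h.2 D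

theorem along_le_add {γ : Curve M} (hγ : Rectifiable γ) (hΛ : MeasurableSet Λ)
    {ρ ρ' : MassDistribution Λ} {c : ℝ≥0∞} (hc : c ≠ ⊤) {w : M → ℝ≥0∞}
    {a : complComponents Λ → ℝ≥0∞} (hcont : ∀ x, (ρ.cont x : ℝ≥0∞) ≤ ρ'.cont x + c * w x)
    (hdisc : ∀ D, (ρ.disc D : ℝ≥0∞) ≤ ρ'.disc D + c * a D) :
    ρ.along γ ≤ ρ'.along γ + c * (lineIntegral (Λ.indicator w) γ +
      ∑' D : {D : complComponents Λ // (range γ ∩ (D : Set M)).Nonempty}, a D) := by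
  have h1 : lineIntegral (Λ.indicator fun x => (ρ.cont x : ℝ≥0∞)) γ ≤
      lineIntegral (Λ.indicator fun x => (ρ'.cont x : ℝ≥0∞)) γ +
        c * lineIntegral (Λ.indicator w) γ := by
    rw [← lineIntegral_const_mul hc,
      ← lineIntegral_add hγ (ρ'.measurable_cont.coe_nnreal_ennreal.indicator hΛ)]
    refine lineIntegral_mono (fun x => ?_) γ
    by_cases hx : x ∈ Λ
    · simpa only [indicator_of_mem hx] using hcont x
    · simp [indicator_of_notMem hx]
  refine (add_le_add h1 (ENNReal.tsum_le_tsum fun D : {D : complComponents Λ //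
    (range γ ∩ (D : Set M)).Nonempty} => hdisc D)).trans (le_of_eq ?_)
  rw [ENNReal.tsum_add, ENNReal.tsum_mul_left, along, mul_add, add_add_add_comm]

theorem exists_mass_lt {Γ : Set (Curve M)} (hΓ : transboundaryModulus n Λ Γ ≠ ⊤) {ε : ℝ≥0∞}
    (hε : ε ≠ 0) : ∃ ρ : MassDistribution Λ, ρ.Admissible n Γ ∧
      ρ.mass n ≤ transboundaryModulus n Λ Γ + ε := by
  have h := ENNReal.lt_add_right hΓ hε
  conv_lhs at h => rw [transboundaryModulus]
  simp only [iInf_lt_iff] at h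
  obtain ⟨ρ, hρ, hlt⟩ := h
  exact ⟨ρ, hρ, hlt.le⟩

/-- Given mass distributions of rapidly decreasing mass, the supremum of `2ʲ ρ j` has finite
mass. -/
theorem iSup_mass_ne_top (ρ : ℕ → MassDistribution Λ)
    (h : ∀ j, (ρ j).mass n ≤ ((2 ^ n)⁻¹ * 2⁻¹) ^ j) :
    ∫⁻ x in Λ, (⨆ j : ℕ, 2 ^ j * ((ρ j).cont x : ℝ≥0∞)) ^ n ∂(riemannianVolume n) ≠ ⊤ ∧
    ∑' D, (⨆ j : ℕ, 2 ^ j * ((ρ j).disc D : ℝ≥0∞)) ^ n ≠ ⊤ := by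
  have hsum : ∑' j : ℕ, (2 ^ j) ^ n * (ρ j).mass n ≠ ⊤ := by
    refine ne_top_of_le_ne_top (b := ∑' j : ℕ, (2⁻¹ : ℝ≥0∞) ^ j)
      (by rw [ENNReal.tsum_geometric_two]; finiteness) (ENNReal.tsum_le_tsum fun j => ?_)
    calc ((2 : ℝ≥0∞) ^ j) ^ n * (ρ j).mass n ≤ (2 ^ j) ^ n * ((2 ^ n)⁻¹ * 2⁻¹) ^ j := by
          gcongr
          exact h j
      _ = (2 ^ n * (2 ^ n)⁻¹) ^ j * 2⁻¹ ^ j := by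
          rw [mul_pow, mul_pow, ← pow_mul, ← pow_mul, mul_comm j n, mul_assoc]
      _ = 2⁻¹ ^ j := by
          rw [ENNReal.mul_inv_cancel (by positivity) (by finiteness), one_pow, one_mul]
  have hsup : ∀ u : ℕ → ℝ≥0, (⨆ j : ℕ, 2 ^ j * (u j : ℝ≥0∞)) ^ n ≤
      ∑' j : ℕ, (2 ^ j) ^ n * (u j : ℝ≥0∞) ^ n := fun u => by
    rw [ENNReal.iSup_pow]
    refine iSup_le fun j => ?_
    rw [mul_pow]
    exact ENNReal.le_tsum (f := fun j : ℕ => ((2 : ℝ≥0∞) ^ j) ^ n * (u j : ℝ≥0∞) ^ n) j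
  constructor
  · refine ne_top_of_le_ne_top hsum ((lintegral_mono fun x => hsup _).trans ?_)
    rw [lintegral_tsum fun j =>
      (((ρ j).measurable_cont.coe_nnreal_ennreal.pow_const n).const_mul _).aemeasurable]
    refine ENNReal.tsum_le_tsum fun j => ?_
    rw [lintegral_const_mul' _ _ (by finiteness)]
    gcongr
    exact le_self_add
  · refine ne_top_of_le_ne_top hsum ((ENNReal.tsum_le_tsum fun D => hsup _).trans ?_)
    rw [ENNReal.tsum_comm]
    refine ENNReal.tsum_le_tsum fun j => ?_
    rw [ENNReal.tsum_mul_left]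
    gcongr
    exact le_add_self

/-- Lower semicontinuity of the mass makes the limit inferior of a minimizing sequence a minimizer
as soon as it is admissible. The dominating pair `(w, a)` gives this: along almost every curve the
`k`-th distribution exceeds the limit by at most `4 / 2 ^ k` times a finite number `T`. -/
theorem exists_isExtremal (hn : 2 ≤ n) (hΛ : MeasurableSet Λ) {Γ : Set (Curve M)}
    (hΓ : transboundaryModulus n Λ Γ ≠ ⊤)
    (hdens : ∀ a : complComponents Λ → ℝ≥0∞, ∑' D, a D ^ n ≠ ⊤ →
      ∃ g : M → ℝ≥0∞, Measurable g ∧ ∫⁻ x, g x ^ n ∂(riemannianVolume n) ≠ ⊤ ∧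
        ∀ γ : Curve M, Rectifiable γ → lineIntegral g γ ≠ ⊤ →
          ∑' D : {D : complComponents Λ // (range γ ∩ (D : Set M)).Nonempty}, a D ≠ ⊤) :
    ∃ ρ : MassDistribution Λ, ρ.IsExtremal n Γ := by
  have hn0 : n ≠ 0 := by omega
  -- With excess mass `q ^ k`, the half distances have mass at most `q ^ k`. The factor `(2 ^ n)⁻¹`
  -- pays for the weights `2 ^ j` in `w` and `a`, and `2⁻¹` makes the series converge.
  set q : ℝ≥0∞ := (2 ^ n)⁻¹ * 2⁻¹ with hq
  have hq0 : q ≠ 0 := mul_ne_zero (by simp) (by simp)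
  have hq1 : q < 1 := by
    calc q ≤ 1 * 2⁻¹ := by
          rw [hq]
          gcongr
          rw [ENNReal.inv_le_one]
          exact one_le_pow_of_one_le' one_le_two n
      _ < 1 := by rw [one_mul]; exact ENNReal.one_half_lt_one
  choose ρ hρ hρm using fun k => exists_mass_lt hΓ (pow_ne_zero k hq0)
  have hh : ∀ j, (halfDist (ρ j) (ρ (j + 1))).mass n ≤ q ^ j := fun j =>
    (hρ j).mass_halfDist_le hn hΛ hΓ (hρ (j + 1)) (hρm j) ((hρm (j + 1)).trans (add_le_add le_rfl
      (pow_le_pow_of_le_one zero_le hq1.le (Nat.le_succ j))))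
  obtain ⟨hw, ha⟩ := iSup_mass_ne_top (fun j => halfDist (ρ j) (ρ (j + 1))) hh
  set w : M → ℝ≥0∞ := fun x =>
    ⨆ j : ℕ, 2 ^ j * ((halfDist (ρ j) (ρ (j + 1))).cont x : ℝ≥0∞) with hwdef
  set a : complComponents Λ → ℝ≥0∞ := fun D =>
    ⨆ j : ℕ, 2 ^ j * ((halfDist (ρ j) (ρ (j + 1))).disc D : ℝ≥0∞) with hadef
  have hwm : Measurable w := Measurable.iSup fun j =>
    (halfDist (ρ j) (ρ (j + 1))).measurable_cont.coe_nnreal_ennreal.const_mul _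
  obtain ⟨g, hgm, hgi, hg⟩ := hdens a ha
  choose Γ₀ hΓ₀ hΓ₀m hΓ₀a using hρ
  have hadm : (liminf ρ).Admissible n Γ := by
    -- Besides the exceptional curves of each `ρ k`, discard those on which arc length, `g` or `w`
    -- on `Λ` has infinite integral; finiteness for `g` controls the sum of `a`.
    refine ⟨Γ ∩ ((⋃ k, Γ₀ k) ∪ {γ | ¬ Rectifiable γ} ∪ {γ | lineIntegral g γ = ⊤} ∪
      {γ | lineIntegral (Λ.indicator w) γ = ⊤}), inter_subset_left, ?_, ?_⟩
    · refine le_antisymm ((modulus_mono inter_subset_right).trans (le_of_eq ?_)) (zero_le)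
      refine modulus_union_eq_zero (modulus_union_eq_zero (modulus_union_eq_zero
        (modulus_iUnion_eq_zero hΓ₀m) (modulus_not_rectifiable hn0))
        (modulus_lineIntegral_eq_top hn0 hgm hgi))
        (modulus_lineIntegral_eq_top hn0 (hwm.indicator hΛ) ?_)
      have hind : ∀ x, Λ.indicator w x ^ n = Λ.indicator (fun x => w x ^ n) x := fun x => by
        by_cases hx : x ∈ Λ <;> simp [hx, hn0]
      simp_rw [hind]
      rwa [lintegral_indicator hΛ]
    · rintro γ ⟨hγ, hnot⟩
      simp only [mem_inter_iff, hγ, true_and, mem_union, not_or, mem_iUnion, not_exists] at hnot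
      obtain ⟨⟨⟨hγ0, hr⟩, hgγ⟩, hwγ⟩ := hnot
      have hγr : Rectifiable γ := not_not.1 hr
      set T := lineIntegral (Λ.indicator w) γ +
        ∑' D : {D : complComponents Λ // (range γ ∩ (D : Set M)).Nonempty}, a D with hT
      have hTt : T ≠ ⊤ := ENNReal.add_ne_top.2 ⟨hwγ, hg γ hγr hgγ⟩
      have hk : ∀ k : ℕ, 1 ≤ (liminf ρ).along γ + 4 / 2 ^ k * T := fun k =>
        (hΓ₀a k γ ⟨hγ, hγ0 k⟩).trans (along_le_add hγr hΛ
          (ENNReal.div_ne_top (by finiteness) (by positivity))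
          (fun x => coe_le_liminf_add (fun k => (ρ k).cont x) k)
          (fun D => coe_le_liminf_add (fun k => (ρ k).disc D) k))
      have hlim : Filter.Tendsto (fun k : ℕ => (liminf ρ).along γ + 4 / 2 ^ k * T) Filter.atTop
          (nhds ((liminf ρ).along γ + 4 * 0 * T)) := by
        refine tendsto_const_nhds.add (ENNReal.Tendsto.mul_const ?_ (Or.inr hTt))
        have h4 : (fun k : ℕ => (4 : ℝ≥0∞) / 2 ^ k) = fun k => 4 * 2⁻¹ ^ k := by
          ext k
          rw [div_eq_mul_inv, ENNReal.inv_pow]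
        rw [h4]
        exact ENNReal.Tendsto.const_mul
          (ENNReal.tendsto_pow_atTop_nhds_zero_of_lt_one ENNReal.one_half_lt_one)
          (Or.inr ENNReal.ofNat_ne_top)
      rw [mul_zero, zero_mul, add_zero] at hlim
      exact ge_of_tendsto' hlim hk
  refine ⟨liminf ρ, hadm, le_antisymm ?_ (transboundaryModulus_le hadm)⟩
  have hlim : Filter.Tendsto (fun k : ℕ => transboundaryModulus n Λ Γ + q ^ k) Filter.atTop
      (nhds (transboundaryModulus n Λ Γ + 0)) :=
    tendsto_const_nhds.add (ENNReal.tendsto_pow_atTop_nhds_zero_of_lt_one hq1)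
  rw [add_zero] at hlim
  calc (liminf ρ).mass n ≤ Filter.liminf (fun k => (ρ k).mass n) Filter.atTop := mass_liminf_le ρ
    _ ≤ Filter.liminf (fun k : ℕ => transboundaryModulus n Λ Γ + q ^ k) Filter.atTop :=
        Filter.liminf_le_liminf (Filter.Eventually.of_forall hρm)
    _ = transboundaryModulus n Λ Γ := hlim.liminf_eq

theorem IsExtremal.eq (hn : 2 ≤ n) (hΛ : MeasurableSet Λ) {Γ : Set (Curve M)}
    (hΓ : transboundaryModulus n Λ Γ ≠ ⊤) {ρ ρ' : MassDistribution Λ} (h : ρ.IsExtremal n Γ)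
    (h' : ρ'.IsExtremal n Γ) :
    (∀ᵐ x ∂((riemannianVolume n).restrict Λ), ρ.cont x = ρ'.cont x) ∧ ρ.disc = ρ'.disc :=
  ae_eq_of_mass_halfDist_eq_zero (by omega) <| nonpos_iff_eq_zero.1 <|
    h.1.mass_halfDist_le hn hΛ hΓ h'.1 (by rw [h.2, add_zero]) (by rw [h'.2, add_zero])

theorem exists_represents (hn : n ≠ 0) {ρ : MassDistribution Λ} (h : ρ.mass n ≠ ⊤) :
    ∃ x : LnSum n Λ, ρ.Represents x := by
  rw [mass, Ne, ENNReal.add_eq_top, not_or] at h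
  have hmem : MemLp (fun x => (ρ.cont x : ℝ)) n ((riemannianVolume n).restrict Λ) := by
    refine ⟨ρ.measurable_cont.coe_nnreal_real.aestronglyMeasurable, ?_⟩
    rw [eLpNorm_lt_top_iff_lintegral_rpow_enorm_lt_top (by simpa using hn)
      (ENNReal.natCast_ne_top n)]
    refine lt_of_le_of_lt (le_of_eq (lintegral_congr fun x => ?_)) (lt_top_iff_ne_top.2 h.1)
    simp [Real.enorm_eq_ofReal (ρ.cont x).coe_nonneg]
  have hmem' : Memℓp (fun D => (ρ.disc D : ℝ)) (n : ℝ≥0∞) := by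
    refine memℓp_gen ?_
    have hs : Summable fun D => ρ.disc D ^ n := by
      rw [← ENNReal.tsum_coe_ne_top_iff_summable]
      simpa using h.2
    have hs' := NNReal.summable_coe.2 hs
    simpa using hs'
  refine ⟨WithLp.toLp _ (hmem.toLp _, ⟨_, hmem'⟩), hmem.coeFn_toLp, fun D => rfl⟩

end MassDistribution

end MassDistribution

end Transboundary

/-! ### The theorem. -/

theorem propositionP (n : ℕ) (hn : 2 ≤ n)
    {M : Type*} [EMetricSpace M] [SecondCountableTopology M]
    [ChartedSpace (EuclideanSpace ℝ (Fin n)) M] [IsManifold (𝓡 n) ∞ M]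
    [RiemannianBundle (fun x : M => TangentSpace (𝓡 n) x)]
    [IsContMDiffRiemannianBundle (𝓡 n) ∞ (EuclideanSpace ℝ (Fin n))
      (fun x : M => TangentSpace (𝓡 n) x)]
    [IsRiemannianManifold (𝓡 n) M]
    [MeasurableSpace M] [BorelSpace M]
    (Λ : Set M) (hΛ : IsCompact Λ)
    (Γ : Set (Transboundary.Curve M))
    (hΓ : Transboundary.transboundaryModulus n Λ Γ < ⊤)
    (hD : Transboundary.BoundedGeometry
      (fun D : Transboundary.complComponents Λ => (D : Set M))) :
    ∃ x : Transboundary.LnSum n Λ,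
      (∃ ρ : Transboundary.MassDistribution Λ, ρ.IsExtremal n Γ) ∧
      ∀ ρ : Transboundary.MassDistribution Λ, ρ.IsExtremal n Γ → ρ.Represents x := by
  have : IsManifold (𝓡 n) 1 M := IsManifold.of_le (n := ∞) (by norm_num)
  have : IsContinuousRiemannianBundle (EuclideanSpace ℝ (Fin n))
      (fun x : M => TangentSpace (𝓡 n) x) := by
    obtain ⟨g, hg, h⟩ := IsContMDiffRiemannianBundle.exists_contMDiff (IB := 𝓡 n) (n := ∞)
      (F := EuclideanSpace ℝ (Fin n)) (E := fun x : M => TangentSpace (𝓡 n) x)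
    exact ⟨g, hg.continuous, h⟩
  have : LocallyConnectedSpace M :=
    ChartedSpace.locallyConnectedSpace (EuclideanSpace ℝ (Fin n)) M
  have : LocallyCompactSpace M := ChartedSpace.locallyCompactSpace (EuclideanSpace ℝ (Fin n)) M
  have := Transboundary.isLocallyFiniteMeasure_riemannianVolume n M
  have hn0 : n ≠ 0 := by omega
  obtain ⟨ρ, hρ⟩ := Transboundary.MassDistribution.exists_isExtremal hn hΛ.measurableSet hΓ.ne
    fun a ha => hD.exists_density hΛ hn (Transboundary.exists_regularNear n hΛ) ha
  -- Finite mass places one extremal distribution in `Lⁿ(Λ) ⊕ ℓⁿ`; by uniqueness its class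
  -- represents every other one.
  obtain ⟨x, hx⟩ := ρ.exists_represents hn0 (hρ.2.trans_ne hΓ.ne)
  refine ⟨x, ⟨ρ, hρ⟩, fun ρ' hρ' => ?_⟩
  obtain ⟨h1, h2⟩ := hρ.eq hn hΛ.measurableSet hΓ.ne hρ'
  refine ⟨?_, fun D => by rw [hx.2 D, h2]⟩
  filter_upwards [h1, hx.1] with y hy hxy
  rw [hxy, hy]
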